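/- **Setting.** Let $\mathbf a\in\mathbb R^d$ have $\mathbb Q$-linearly independent components, and order $\mathbb Z^d$ by $\mathbf u\le\mathbf v\iff\langle\mathbf u,\mathbf a\rangle\le\langle\mathbf v,\mathbf a\rangle$. Let $(R,\mathfrak m,\Bbbk)$ be a Noetherian local domain of dimension $d$ with fraction field $\mathbb F$. For a valuation $\nu:\mathbb F^\times\to\mathbb Z^d$ put $\mathbb F_{\ge g}=\{x\ne0:\nu(x)\ge g\}\cup\{0\}$; let $\Bbbk_\nu$ be the residue field of the valuation ring $\mathbb F_{\ge0}$, and $\nu(I)=\{\nu(r):0\ne r\in I\}$ for an ideal $I$ of $R$ (in particular for $I=R$). Let $\mathrm{Cone}(U)$ be the closure of the set of nonnegative linear combinations of elements of $U\subset\mathbb R^d$. The valuation $\nu$ is *OK relative to $R$* if: (1) $\mathbb Z\nu(R)=\nu(\mathbb F^\times)=\mathbb Z^d$; (2) $R$ is dominated by $\nu$, i.e. $\nu\ge0$ on $R\setminus\{0\}$ and $\nu>0$ on $\mathfrak m\setminus\{0\}$; (3) $C=\mathrm{Cone}(\nu(R))$ is pointed at direction $\mathbf a$, i.e. there is $0<c<\|\mathbf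 a\|$ with $\langle\mathbf x,\mathbf a\rangle\ge c\|\mathbf x\|$ for all $\mathbf x\in C$ (so $d\ge1$); (4) $[\Bbbk_\nu:\Bbbk]<\infty$; (5) there is $\mathbf v\in\mathbb Z^d$ with $R\cap\mathbb F_{\ge n\mathbf v}\subset\mathfrak m^n$ for all $n\in\mathbb N$. An *OK domain* is an $R$ that admits such a $\nu$. Assume that $R$ is an OK domain and fix any valuation $\nu$ that is OK relative to $R$. Write $\nu^c(I)=\nu(R)\setminus\nu(I)$ and $C^\circ$ for the interior of $C$. For a family $I_\bullet=\{I_n\}$ of ideals of $R$, indexed by all $n\in\mathbb N$ or by the powers $n=q=p^e$ $(e\ge0)$ of a prime $p$, let $$\nabla_n=\bigcup_{\mathbf u\in\frac1n\nu^c(I_n)}\ \prod_{i=1}^d\left[u_i,u_i+\tfrac1n\right)\quad(n\ge1),$$ $$\nabla^{up}=\{\mathbf x\in C^\circ:\mathbf x\in\nabla_n\text{ for infinitely many indices }n\},\qquad \nabla^{low}=\{\mathbf x\in C^\circ:\mathbf x\in\nabla_n\text{ for all but finitely many indices }n\}.$$ The family is *BBL* (bounded below linearly) if there is $c\in\mathbb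 N$ with $\mathfrak m^{cn}\subset I_n$ for all indices $n$. It is *weakly graded* (indexed by $\mathbb N$) if there is $0\ne c\in R$ with $cI_mI_n\subset I_{m+n}$ for all $m,n\in\mathbb N$. If $R$ has characteristic $p>0$ and the index set is the set of powers of $p$, it is a *weakly $p$-family* (resp. a *weakly inverse $p$-family*) if there is $0\ne c\in R$ with $cI_q^{[p]}\subset I_{pq}$ (resp. $cI_{pq}\subset I_q^{[p]}$) for all $q=p^e$, where $I^{[p]}$ is the ideal generated by the $p$-th powers of the elements of $I$. Let $\ell$ denote length and $\mathrm{vol}$ Lebesgue measure. **Theorem.** (a) If $I_\bullet$ is a BBL weakly graded family (any characteristic), then the following limit exists, is finite, and $$\lim_{n\to\infty}\frac{\ell(R/I_n)}{n^d}=[\Bbbk_\nu:\Bbbk]\,\mathrm{vol}(\nabla^{low})=[\Bbbk_\nu:\Bbbk]\,\mathrm{vol}(\nabla^{up}).$$ (b) If $R$ has characteristic $p>0$ and $I_\bullet$ is a BBL weakly $p$-family, then the following limit exists, is finite, and $$\lim_{q\to\infty}\frac{\ell(R/I_q)}{q^d}=[\Bbbk_\nu:\Bbbk]\,\mathrm{vol}(\nabla^{up}).$$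 (c) If $R$ has characteristic $p>0$, is $F$-finite (a finite module over itself via the Frobenius map), and $\Bbbk$ is perfect, and if $I_\bullet$ is a BBL weakly inverse $p$-family, then the following limit exists, is finite, and $$\lim_{q\to\infty}\frac{\ell(R/I_q)}{q^d}=[\Bbbk_\nu:\Bbbk]\,\mathrm{vol}(\nabla^{up}).$$ -/

import Mathlib

open MeasureTheory Filter Topology
open scoped ENNReal

namespace OKDomain

noncomputable section

/-! ### The lattice `ℤ^d` ordered by a vector with `ℚ`-linearly independent components -/

/-- An integer vector, seen as a point of Euclidean space. -/
def latticePoint {d : ℕ} (u : Fin d → ℤ) : EuclideanSpace ℝ (Fin d) :=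
  WithLp.toLp 2 (fun i => (u i : ℝ))

/-- The group `ℤ^d`, to be ordered by `u ≤ v ↔ ⟪u, a⟫ ≤ ⟪v, a⟫`. -/
def OrdLattice {d : ℕ} (a : EuclideanSpace ℝ (Fin d))
    (_ha : LinearIndependent ℚ (fun i => a i)) : Type :=
  Fin d → ℤ

section Lattice

variable {d : ℕ} {a : EuclideanSpace ℝ (Fin d)} {ha : LinearIndependent ℚ (fun i => a i)}

instance : AddCommGroup (OrdLattice a ha) := inferInstanceAs (AddCommGroup (Fin d → ℤ))

/-- The inclusion `ℤ^d ⊂ ℝ^d`. -/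
def OrdLattice.toEuclidean (u : OrdLattice a ha) : EuclideanSpace ℝ (Fin d) :=
  latticePoint u

/-- The embedding `ℤ^d → ℝ`, `u ↦ ⟪u, a⟫`. -/
def OrdLattice.toReal (u : OrdLattice a ha) : ℝ :=
  inner ℝ u.toEuclidean a

theorem OrdLattice.toReal_eq (u : OrdLattice a ha) :
    u.toReal = ∑ i, (((show Fin d → ℤ from u) i : ℤ) : ℝ) * a i := by
  simp [OrdLattice.toReal, OrdLattice.toEuclidean, latticePoint, PiLp.inner_apply, mul_comm]

theorem OrdLattice.toReal_add (u v : OrdLattice a ha) :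
    (u + v).toReal = u.toReal + v.toReal := by
  simp only [OrdLattice.toReal_eq, ← Finset.sum_add_distrib, ← add_mul]
  refine Finset.sum_congr rfl fun i _ => ?_
  congr 1
  exact_mod_cast rfl

theorem OrdLattice.toReal_injective :
    Function.Injective (OrdLattice.toReal : OrdLattice a ha → ℝ) := by
  intro u v huv
  rw [OrdLattice.toReal_eq, OrdLattice.toReal_eq] at huv
  have h := Fintype.linearIndependent_iff.mp ha
    (fun i => (((show Fin d → ℤ from u) i - (show Fin d → ℤ from v) i : ℤ) : ℚ)) (by
      have : ∀ i, (((show Fin d → ℤ from u) i - (show Fin d → ℤ from v) i : ℤ) : ℚ) • a i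
          = (((show Fin d → ℤ from u) i : ℤ) : ℝ) * a i
            - (((show Fin d → ℤ from v) i : ℤ) : ℝ) * a i := by
        intro i
        rw [Rat.smul_def]
        push_cast
        ring
      rw [Finset.sum_congr rfl fun i _ => this i, Finset.sum_sub_distrib, huv, sub_self])
  funext i
  have hi := h i
  exact sub_eq_zero.mp (by exact_mod_cast hi)

instance : LinearOrder (OrdLattice a ha) :=
  LinearOrder.lift' OrdLattice.toReal OrdLattice.toReal_injective

theorem OrdLattice.le_iff (u v : OrdLattice a ha) : u ≤ v ↔ u.toReal ≤ v.toReal := Iff.rfl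

instance : IsOrderedAddMonoid (OrdLattice a ha) where
  add_le_add_left u v huv w := by
    rw [OrdLattice.le_iff] at huv ⊢
    rw [OrdLattice.toReal_add, OrdLattice.toReal_add]
    linarith

end Lattice

/-! ### Cones -/

section Cones

variable {d : ℕ}

/-- `Cone(U)`: the closure of the set of all nonnegative linear combinations of elements
of `U`. -/
def closedCone (U : Set (EuclideanSpace ℝ (Fin d))) : Set (EuclideanSpace ℝ (Fin d)) :=
  closure (PointedCone.hull ℝ U : Set (EuclideanSpace ℝ (Fin d)))

/-- `C` is pointed at direction `a`: it lies in a circular cone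
`{x | ⟪x, a⟫ ≥ c ‖x‖}` with `0 < c < ‖a‖`. -/
def IsPointedAt (C : Set (EuclideanSpace ℝ (Fin d))) (a : EuclideanSpace ℝ (Fin d)) : Prop :=
  ∃ c : ℝ, 0 < c ∧ c < ‖a‖ ∧ ∀ x ∈ C, c * ‖x‖ ≤ inner ℝ x a

/-- The half-open cube `∏ᵢ [xᵢ, xᵢ + ε)`. -/
def cube (x : EuclideanSpace ℝ (Fin d)) (ε : ℝ) : Set (EuclideanSpace ℝ (Fin d)) :=
  {y | ∀ i, y i ∈ Set.Ico (x i) (x i + ε)}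

/-- The union of the cubes of edge length `ε` whose lower corners are the points of `L`. -/
def cubeUnion (L : Set (EuclideanSpace ℝ (Fin d))) (ε : ℝ) : Set (EuclideanSpace ℝ (Fin d)) :=
  ⋃ x ∈ L, cube x ε

end Cones

/-! ### OK valuations -/

section Valuations

variable {d : ℕ} {a : EuclideanSpace ℝ (Fin d)} {ha : LinearIndependent ℚ (fun i => a i)}
variable (R : Type*) [CommRing R] {F : Type*} [Field F] [Algebra R F]

/-- The valuation ring `V_ν = {x | ν x ≥ 0}`. -/
def valuationRing (ν : AddValuation F (WithTop (OrdLattice a ha))) : ValuationSubring F :=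
  (AddValuation.toValuation ν).valuationSubring

theorem mem_valuationRing (ν : AddValuation F (WithTop (OrdLattice a ha))) (x : F) :
    x ∈ valuationRing ν ↔ 0 ≤ ν x := Iff.rfl

/-- The residue field `𝕜_ν` of `ν`. -/
abbrev residueFieldOf (ν : AddValuation F (WithTop (OrdLattice a ha))) : Type _ :=
  IsLocalRing.ResidueField (valuationRing ν)

/-- The local ring `R` is dominated by `ν`: `R ⊂ V_ν` and `𝔪 ⊂ 𝔪_ν`. -/
structure IsDominatedBy [IsLocalRing R] (ν : AddValuation F (WithTop (OrdLattice a ha))) :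
    Prop where
  nonneg : ∀ r : R, 0 ≤ ν (algebraMap R F r)
  pos : ∀ r ∈ IsLocalRing.maximalIdeal R, 0 < ν (algebraMap R F r)

variable {R}

/-- The inclusion `R → V_ν`. -/
def toValuationRing [IsLocalRing R] {ν : AddValuation F (WithTop (OrdLattice a ha))}
    (h : IsDominatedBy R ν) : R →+* valuationRing ν :=
  (algebraMap R F).codRestrict (valuationRing ν) h.nonneg

theorem isLocalHom_toValuationRing [IsLocalRing R]
    {ν : AddValuation F (WithTop (OrdLattice a ha))} (h : IsDominatedBy R ν) :
    IsLocalHom (toValuationRing h) where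
  map_nonunit r hr := by
    by_contra hn
    have hpos := h.pos r ((IsLocalRing.mem_maximalIdeal r).mpr hn)
    obtain ⟨y, hy⟩ := hr.exists_right_inv
    have h1 : algebraMap R F r * (y : F) = 1 := congrArg Subtype.val hy
    have h2 : ν (algebraMap R F r) + ν (y : F) = 0 := by
      rw [← AddValuation.map_mul, h1, AddValuation.map_one]
    have h3 : 0 ≤ ν (y : F) := (mem_valuationRing ν _).mp y.2
    exact absurd h2 (add_pos_of_pos_of_nonneg hpos h3).ne'

/-- The field extension `𝕜 → 𝕜_ν` induced by `R → V_ν`. -/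
def residueExtension [IsLocalRing R] {ν : AddValuation F (WithTop (OrdLattice a ha))}
    (h : IsDominatedBy R ν) : IsLocalRing.ResidueField R →+* residueFieldOf ν :=
  haveI := isLocalHom_toValuationRing h
  IsLocalRing.ResidueField.map (toValuationRing h)

/-- The degree `[𝕜_ν : 𝕜]`. -/
def residueDegree [IsLocalRing R] {ν : AddValuation F (WithTop (OrdLattice a ha))}
    (h : IsDominatedBy R ν) : ℕ :=
  letI := (residueExtension h).toAlgebra
  Module.finrank (IsLocalRing.ResidueField R) (residueFieldOf ν)

/-- `ν(I) = {ν(r) | 0 ≠ r ∈ I}`, a subset of `ℤ^d`; the restriction `r ≠ 0` is automatic since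
`ν 0 = ⊤`. -/
def valueSet (ν : AddValuation F (WithTop (OrdLattice a ha))) (I : Ideal R) :
    Set (OrdLattice a ha) :=
  {u | ∃ r ∈ I, ν (algebraMap R F r) = (u : WithTop (OrdLattice a ha))}

variable (R) in
/-- The value semigroup `ν(R)`. -/
def valueSemigroup (ν : AddValuation F (WithTop (OrdLattice a ha))) : Set (OrdLattice a ha) :=
  valueSet ν (⊤ : Ideal R)

/-- `ν^c(I) = ν(R) \ ν(I)`. -/
def valueCompl (ν : AddValuation F (WithTop (OrdLattice a ha))) (I : Ideal R) :
    Set (OrdLattice a ha) :=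
  valueSemigroup R ν \ valueSet ν I

variable (R) in
/-- `Cone(ν(R)) ⊂ ℝ^d`. -/
def valueCone (ν : AddValuation F (WithTop (OrdLattice a ha))) :
    Set (EuclideanSpace ℝ (Fin d)) :=
  closedCone (OrdLattice.toEuclidean '' valueSemigroup R ν)

variable (R) in
/-- `ν : F^× → ℤ^d` (with `ℤ^d` ordered by `a`) is OK relative to the local domain `R` of
dimension `d` with fraction field `F`. -/
structure IsOKValuation [IsLocalRing R] (ν : AddValuation F (WithTop (OrdLattice a ha))) :
    Prop where
  /-- `dim R = d`. -/
  dim_eq : ringKrullDim R = d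
  /-- `ℤ ν(R) = ℤ^d`. -/
  closure_eq_top : AddSubgroup.closure (valueSemigroup R ν) = ⊤
  /-- `ν(F) = ℤ^d`. -/
  surjective : ∀ u : OrdLattice a ha, ∃ x : F, ν x = (u : WithTop (OrdLattice a ha))
  dominated : IsDominatedBy R ν
  pointed : IsPointedAt (valueCone R ν) a
  /-- `[𝕜_ν : 𝕜] < ∞`. -/
  finite_residueExtension : (residueExtension dominated).Finite
  exists_bound : ∃ v : OrdLattice a ha, ∀ (n : ℕ) (r : R),
    ((n • v : OrdLattice a ha) : WithTop (OrdLattice a ha)) ≤ ν (algebraMap R F r) →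
      r ∈ IsLocalRing.maximalIdeal R ^ n

/-! The families below are sequences `I 0, I 1, …` of ideals together with scales
`N 0, N 1, …` in `ℕ`. For a family indexed by `ℕ` the scale of `I n` is `N n = n`; a family
indexed by the powers of `p` is given by `I e = I_{p^e}`, with scale `N e = p^e`. -/

/-- The region `∇_{(1/n) ν^c(I), 1/n} ⊂ ℝ^d`: the union of the cubes of edge length `1/n` with
lower corners in `(1/n) ν^c(I)`. Its characteristic function is `F_{(1/n) ν^c(I), 1/n}`. -/
def complRegion (ν : AddValuation F (WithTop (OrdLattice a ha))) (I : Ideal R) (n : ℕ) :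
    Set (EuclideanSpace ℝ (Fin d)) :=
  cubeUnion ((fun u : OrdLattice a ha => (1 / (n : ℝ)) • u.toEuclidean) '' valueCompl ν I)
    (1 / (n : ℝ))

/-- `∇^up`: the points of the interior of `Cone(ν(R))` that lie in infinitely many of the
regions of the family. -/
def nablaUp (ν : AddValuation F (WithTop (OrdLattice a ha))) (N : ℕ → ℕ) (I : ℕ → Ideal R) :
    Set (EuclideanSpace ℝ (Fin d)) :=
  {x | x ∈ interior (valueCone R ν) ∧ ∃ᶠ k in atTop, x ∈ complRegion ν (I k) (N k)}

/-- `∇^low`: the points of the interior of `Cone(ν(R))` that lie in all but finitely many of the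
regions of the family. -/
def nablaLow (ν : AddValuation F (WithTop (OrdLattice a ha))) (N : ℕ → ℕ) (I : ℕ → Ideal R) :
    Set (EuclideanSpace ℝ (Fin d)) :=
  {x | x ∈ interior (valueCone R ν) ∧ ∀ᶠ k in atTop, x ∈ complRegion ν (I k) (N k)}

end Valuations

/-! ### Families of ideals -/

section Families

variable {R : Type*} [CommRing R]

variable (R) in
/-- `R°`: the complement of the union of the primes `P` with `dim R/P = dim R`. -/
def topDimCompl : Set R :=
  {c | ∀ P : Ideal R, P.IsPrime → ringKrullDim (R ⧸ P) = ringKrullDim R → c ∉ P}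

/-- A family is bounded below linearly: `𝔪^(c n) ⊂ I_n` for a constant `c ∈ ℕ`, where `n` runs
over the scales. -/
def IsBBL [IsLocalRing R] (N : ℕ → ℕ) (I : ℕ → Ideal R) : Prop :=
  ∃ c : ℕ, ∀ k, IsLocalRing.maximalIdeal R ^ (c * N k) ≤ I k

/-- `c I_m I_n ⊂ I_{m+n}` for some `c ∈ R°`. -/
def IsWeaklyGraded (I : ℕ → Ideal R) : Prop :=
  ∃ c ∈ topDimCompl R, ∀ m n, Ideal.span {c} * (I m * I n) ≤ I (m + n)

/-- The Frobenius power `I^[p]`, generated by the `p`-th powers of the elements of `I`. -/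
def frobeniusPower (p : ℕ) (I : Ideal R) : Ideal R :=
  Ideal.span ((fun x => x ^ p) '' (I : Set R))

/-- `c I_q^[p] ⊂ I_{pq}` for some `c ∈ R°`, where `I e = I_{p^e}`. -/
def IsWeaklyP (p : ℕ) (I : ℕ → Ideal R) : Prop :=
  ∃ c ∈ topDimCompl R, ∀ e, Ideal.span {c} * frobeniusPower p (I e) ≤ I (e + 1)

/-- `c I_{pq} ⊂ I_q^[p]` for some `c ∈ R°`, where `I e = I_{p^e}`. -/
def IsWeaklyInverseP (p : ℕ) (I : ℕ → Ideal R) : Prop :=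
  ∃ c ∈ topDimCompl R, ∀ e, Ideal.span {c} * I (e + 1) ≤ frobeniusPower p (I e)

variable (R) in
/-- `R` is `F`-finite: `R` is a finite module over itself through the Frobenius map. -/
def IsFFinite (p : ℕ) [ExpChar R p] : Prop := (frobenius R p).Finite

/-- The normalized colength `ℓ(R/I) / n^d`. -/
def normalizedColength (d : ℕ) (I : Ideal R) (n : ℕ) : ℝ≥0∞ :=
  ((Module.length R (R ⧸ I) : ℕ∞) : ℝ≥0∞) / (n : ℝ≥0∞) ^ d

end Families

end

end OKDomain

namespace OKDomain

/-! ### Lattice points of Euclidean space -/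

section LatticePoints

variable {d : ℕ}

/-! Write S = ν(R) and δ = [𝕜_ν : 𝕜]. The proof turns colengths into counts of lattice points, and
these into volumes.

Colengths. Pointedness leaves only finitely many elements of S below any threshold, so R/I can be
filtered by the ideals {ν ≥ u}. The jump at u is a quotient of {ν ≥ u}/{ν > u}, which leading forms
embed in 𝕜_ν; hence its length is at most δ. A common denominator of lifts of generators of 𝕜_ν over
𝕜 has a value w, independent of I, such that the jump vanishes if u - w ∈ ν(I) and has length δ if u
- w ∈ S and u ∉ ν(I) (`exists_shift`). The BBL condition puts some {ν ≥ β} inside I, and summation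
gives δ #{u : u - w ∈ S, u ∉ ν(I), u < β} ≤ ℓ(R/I) ≤ δ #{u ∈ S : u - w ∉ ν(I), u < β}.

Volumes. A fixed shift w disappears after rescaling. Lattice points deep in the cone of S belong to
S, and ν(I_n) is stable under adding S. If the upper Kuratowski limit of the sets ν(I_n)/n lies in
the lower one, the cells of S \ ν(I_n), and those of both shifted sets above, therefore stabilize
off the boundaries of C and of (upper limit) + C°. Both boundaries are null: the first by convexity,
the second because it is disjoint from its translates along an interior direction. So bounds, ∇^up
and ∇^low share one limit set (`ae_eventually_floorVec_mem_iff`,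
`IsOKValuation.tendsto_normalizedColength`).

Agreement of the Kuratowski limits is where the families differ. For graded families and p-families,
products and p-th powers carry a value at one scale to nearby values at all later scales. For
inverse p-families values must be carried back. Elements g_i with values i ∈ {0, …, p-1}^d are
independent over F^p, since the values of r^p g_i differ mod p. They form a basis once [F : F^p] ≤
p^d. The value of an element is then the value of one term r_i^p g_i of its expansion, and a cleared
coordinate functional maps I^[p] into I, which gives an element of I_q whose value is close to u/p.

The bound [F : F^p] ≤ p^d follows from the graded case applied to 𝔪^n and (c) + 𝔪^n: Frobenius
compares [F : F^p] ℓ(R/𝔪^n) with ℓ(R/𝔪^(p(n+μ))) up to an error o(n^d)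
(`IsOKValuation.finrank_twist_le`). -/

theorem latticePoint_apply (u : Fin d → ℤ) (i : Fin d) : latticePoint u i = (u i : ℝ) := rfl

theorem latticePoint_add (u v : Fin d → ℤ) :
    latticePoint (u + v) = latticePoint u + latticePoint v := by
  ext i; simp [latticePoint_apply]

theorem latticePoint_sub (u v : Fin d → ℤ) :
    latticePoint (u - v) = latticePoint u - latticePoint v := by
  ext i; simp [latticePoint_apply]

theorem latticePoint_zero : latticePoint (0 : Fin d → ℤ) = 0 := by
  ext i; simp [latticePoint_apply]

theorem latticePoint_nsmul (n : ℕ) (u : Fin d → ℤ) :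
    latticePoint (n • u) = (n : ℝ) • latticePoint u := by
  ext i; simp [latticePoint_apply]

theorem norm_le_sum_abs (x : EuclideanSpace ℝ (Fin d)) : ‖x‖ ≤ ∑ i, |x i| := by
  rw [EuclideanSpace.norm_eq]
  refine Real.sqrt_le_iff.2 ⟨Finset.sum_nonneg fun _ _ => abs_nonneg _, ?_⟩
  simpa using Finset.sum_sq_le_sq_sum_of_nonneg (s := Finset.univ) (f := fun i => |x i|)
    fun _ _ => abs_nonneg _

theorem abs_apply_le_norm (x : EuclideanSpace ℝ (Fin d)) (i : Fin d) : |x i| ≤ ‖x‖ := by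
  simpa using PiLp.norm_apply_le x i

theorem finite_norm_latticePoint_le (B : ℝ) :
    {u : Fin d → ℤ | ‖latticePoint u‖ ≤ B}.Finite := by
  refine (Set.finite_Icc (fun _ => -⌈B⌉) (fun _ => ⌈B⌉)).subset fun u hu => ?_
  have h : ∀ i, |(u i : ℝ)| ≤ ⌈B⌉ := fun i =>
    ((abs_apply_le_norm (latticePoint u) i).trans hu).trans (Int.le_ceil B)
  refine ⟨fun i => ?_, fun i => ?_⟩
  · exact_mod_cast (abs_le.1 (h i)).1
  · exact_mod_cast (abs_le.1 (h i)).2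

/-- The lower corner of the cell of `ℤ^d` that contains `n x`. -/
noncomputable def floorVec (n : ℕ) (x : EuclideanSpace ℝ (Fin d)) : Fin d → ℤ :=
  fun i => ⌊(n : ℝ) * x i⌋

theorem norm_floorVec_sub_le (n : ℕ) (x : EuclideanSpace ℝ (Fin d)) :
    ‖latticePoint (floorVec n x) - (n : ℝ) • x‖ ≤ d := by
  refine (norm_le_sum_abs _).trans ?_
  refine (Finset.sum_le_card_nsmul _ _ 1 fun i _ => ?_).trans (by simp)
  simp only [PiLp.sub_apply, latticePoint_apply, PiLp.smul_apply, smul_eq_mul, floorVec]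
  rw [abs_le]
  constructor <;> linarith [Int.floor_le ((n : ℝ) * x i), Int.lt_floor_add_one ((n : ℝ) * x i)]

theorem measurable_floorVec (n : ℕ) :
    Measurable (floorVec n : EuclideanSpace ℝ (Fin d) → Fin d → ℤ) := by
  refine measurable_pi_lambda _ fun i => ?_
  refine Int.measurable_floor.comp ?_
  fun_prop

theorem measurableSet_floorVec (n : ℕ) (A : Set (Fin d → ℤ)) :
    MeasurableSet {x : EuclideanSpace ℝ (Fin d) | floorVec n x ∈ A} :=
  measurable_floorVec n (Set.to_countable A).measurableSet

theorem volume_floorVec_eq {n : ℕ} (hn : 0 < n) (u : Fin d → ℤ) :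
    volume {x : EuclideanSpace ℝ (Fin d) | floorVec n x = u} = ((n : ℝ≥0∞) ^ d)⁻¹ := by
  have hn' : (0 : ℝ) < n := by exact_mod_cast hn
  have h : {x : EuclideanSpace ℝ (Fin d) | floorVec n x = u} =
      (WithLp.ofLp : EuclideanSpace ℝ (Fin d) → Fin d → ℝ) ⁻¹'
        (Set.univ.pi fun i => Set.Ico ((u i : ℝ) / n) ((u i + 1) / n)) := by
    ext x
    simp only [Set.mem_ofPred_eq, Set.mem_preimage, Set.mem_univ_pi, Set.mem_Ico, funext_iff,
      floorVec, Int.floor_eq_iff, div_le_iff₀ hn', lt_div_iff₀ hn', mul_comm (n : ℝ)]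
  rw [h, (PiLp.volume_preserving_ofLp (Fin d)).measure_preimage
    (MeasurableSet.univ_pi fun i => measurableSet_Ico).nullMeasurableSet, Real.volume_pi_Ico]
  have : ∀ i : Fin d, ((u i : ℝ) + 1) / n - u i / n = (n : ℝ)⁻¹ := fun i => by
    field_simp; ring
  simp only [this, Finset.prod_const, Finset.card_univ, Fintype.card_fin]
  rw [ENNReal.ofReal_inv_of_pos hn', ENNReal.ofReal_natCast, ENNReal.inv_pow]

theorem volume_floorVec_mem {n : ℕ} (hn : 0 < n) {A : Set (Fin d → ℤ)} (hA : A.Finite) :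
    volume {x : EuclideanSpace ℝ (Fin d) | floorVec n x ∈ A} =
      ((A.encard : ℕ∞) : ℝ≥0∞) / (n : ℝ≥0∞) ^ d := by
  have h : {x : EuclideanSpace ℝ (Fin d) | floorVec n x ∈ A} =
      ⋃ u ∈ hA.toFinset, {x | floorVec n x = u} := by
    ext x; simp
  rw [h, measure_biUnion_finset]
  · rw [Finset.sum_congr rfl fun u _ => volume_floorVec_eq hn u, Finset.sum_const,
      hA.encard_eq_coe_toFinset_card, nsmul_eq_mul, div_eq_mul_inv]
    simp
  · intro u _ v _ huv
    exact Set.disjoint_left.2 fun x hx hx' => huv (hx.symm.trans hx')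
  · exact fun u _ => measurableSet_floorVec n {u}

theorem norm_le_of_floorVec_mem {n : ℕ} (hn : 0 < n) {A : Set (Fin d → ℤ)} {B : ℝ}
    (hB : ∀ u ∈ A, ‖latticePoint u‖ ≤ B * n) {x : EuclideanSpace ℝ (Fin d)}
    (hx : floorVec n x ∈ A) : ‖x‖ ≤ B + d := by
  have hn' : (1 : ℝ) ≤ n := by exact_mod_cast hn
  have h1 := hB _ hx
  have h2 := norm_floorVec_sub_le n x
  have h3 : (n : ℝ) * ‖x‖ ≤ B * n + d := by
    have := norm_sub_norm_le ((n : ℝ) • x) (latticePoint (floorVec n x))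
    rw [norm_smul, Real.norm_natCast, norm_sub_rev] at this
    linarith
  have hd : (0 : ℝ) ≤ d := by positivity
  by_contra hlt
  push Not at hlt
  have h4 : (n : ℝ) * (B + d) < n * ‖x‖ := by gcongr
  nlinarith

/-- Counting lattice points computes a volume, when membership of the cells stabilizes almost
everywhere. -/
theorem tendsto_encard_div_pow {N : ℕ → ℕ} (hN : Tendsto N atTop atTop)
    {A : ℕ → Set (Fin d → ℤ)} {B : ℝ} (hB : ∀ n, ∀ u ∈ A n, ‖latticePoint u‖ ≤ B * N n)
    {X : Set (EuclideanSpace ℝ (Fin d))} (hX : MeasurableSet X)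
    (h : ∀ᵐ x, ∀ᶠ n in atTop, floorVec (N n) x ∈ A n ↔ x ∈ X) :
    Tendsto (fun n => (((A n).encard : ℕ∞) : ℝ≥0∞) / (N n : ℝ≥0∞) ^ d) atTop
      (𝓝 (volume X)) := by
  -- From some scale on, all counted cells lie in the ball of radius B + d, so dominated convergence
  -- applies to the indicators.
  have hlim := tendsto_measure_of_ae_tendsto_indicator (μ := volume) atTop hX
    (As := fun n => {x : EuclideanSpace ℝ (Fin d) | floorVec (N n) x ∈ A n})
    (fun n => measurableSet_floorVec _ _)
    (B := Metric.closedBall 0 (B + d)) measurableSet_closedBall measure_closedBall_lt_top.ne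
    ?_ h
  · refine hlim.congr' ?_
    filter_upwards [hN.eventually_gt_atTop 0] with n hn
    exact volume_floorVec_mem hn ((finite_norm_latticePoint_le _).subset (hB n))
  · filter_upwards [hN.eventually_gt_atTop 0] with n hn x hx
    exact mem_closedBall_zero_iff.2 (norm_le_of_floorVec_mem hn (hB n) hx)

/-- Almost every point of X lies in a counted cell at some positive scale, hence in one fixed ball.
-/
theorem volume_lt_top_of_ae_eventually {N : ℕ → ℕ} (hN : Tendsto N atTop atTop)
    {A : ℕ → Set (Fin d → ℤ)} {B : ℝ} (hB : ∀ n, ∀ u ∈ A n, ‖latticePoint u‖ ≤ B * N n)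
    {X : Set (EuclideanSpace ℝ (Fin d))}
    (h : ∀ᵐ x, ∀ᶠ n in atTop, floorVec (N n) x ∈ A n ↔ x ∈ X) : volume X < ⊤ := by
  refine lt_of_le_of_lt (measure_mono_ae ?_)
    (measure_closedBall_lt_top (x := (0 : EuclideanSpace ℝ (Fin d))) (r := B + d))
  filter_upwards [h] with x hx hxX
  obtain ⟨n, hn, hn0⟩ := (hx.and (hN.eventually_gt_atTop 0)).exists
  exact mem_closedBall_zero_iff.2 (norm_le_of_floorVec_mem hn0 (hB n) (hn.2 hxX))

/-- The half-open cubes are exactly the fibres of `floorVec`, so the regions ∇_n can be handled by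
lattice points alone. -/
theorem mem_cubeUnion_iff {n : ℕ} (hn : 0 < n) {A : Set (Fin d → ℤ)}
    (x : EuclideanSpace ℝ (Fin d)) :
    x ∈ cubeUnion ((fun u : Fin d → ℤ => (1 / (n : ℝ)) • latticePoint u) '' A) (1 / (n : ℝ)) ↔
      floorVec n x ∈ A := by
  have hn' : (0 : ℝ) < n := by exact_mod_cast hn
  have key : ∀ u : Fin d → ℤ, x ∈ cube ((1 / (n : ℝ)) • latticePoint u) (1 / (n : ℝ)) ↔
      floorVec n x = u := by
    intro u
    simp only [cube, Set.mem_ofPred_eq, PiLp.smul_apply, latticePoint_apply, smul_eq_mul, Set.mem_Ico,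
      floorVec, funext_iff, Int.floor_eq_iff]
    refine forall_congr' fun i => ?_
    rw [← mul_add_one, one_div, inv_mul_le_iff₀ hn', lt_inv_mul_iff₀ hn']
  simp only [cubeUnion, Set.biUnion_image, Set.mem_iUnion, key, exists_prop]
  exact ⟨fun ⟨u, hu, h⟩ => h ▸ hu, fun h => ⟨_, h, rfl⟩⟩

end LatticePoints

/-! ### Cones of lattice semigroups -/

section SemigroupCone

variable {d : ℕ}

theorem closedCone_add_mem {U : Set (EuclideanSpace ℝ (Fin d))} {x y : EuclideanSpace ℝ (Fin d)}
    (hx : x ∈ closedCone U) (hy : y ∈ closedCone U) : x + y ∈ closedCone U :=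
  map_mem_closure₂ continuous_add hx hy fun _ h _ h' => add_mem h h'

theorem closedCone_smul_mem {U : Set (EuclideanSpace ℝ (Fin d))} {x : EuclideanSpace ℝ (Fin d)}
    (hx : x ∈ closedCone U) {t : ℝ} (ht : 0 ≤ t) : t • x ∈ closedCone U :=
  map_mem_closure (continuous_const_smul t) hx fun _ h =>
    (PointedCone.hull ℝ U).smul_mem ht h

theorem subset_closedCone (U : Set (EuclideanSpace ℝ (Fin d))) : U ⊆ closedCone U :=
  fun _ h => subset_closure (Submodule.subset_span h)

theorem convex_closedCone (U : Set (EuclideanSpace ℝ (Fin d))) : Convex ℝ (closedCone U) :=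
  fun _ hx _ hy _ _ ha hb _ =>
    closedCone_add_mem (closedCone_smul_mem hx ha) (closedCone_smul_mem hy hb)

theorem interior_closedCone_add_mem {U : Set (EuclideanSpace ℝ (Fin d))}
    {x y : EuclideanSpace ℝ (Fin d)}
    (hx : x ∈ closedCone U) (hy : y ∈ interior (closedCone U)) :
    x + y ∈ interior (closedCone U) := by
  have h : (x + ·) '' interior (closedCone U) ⊆ closedCone U := by
    rintro _ ⟨z, hz, rfl⟩
    exact closedCone_add_mem hx (interior_subset hz)
  exact interior_maximal h (isOpenMap_add_left x _ isOpen_interior) ⟨y, hy, rfl⟩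

theorem interior_closedCone_smul_mem {U : Set (EuclideanSpace ℝ (Fin d))}
    {x : EuclideanSpace ℝ (Fin d)}
    (hx : x ∈ interior (closedCone U)) {t : ℝ} (ht : 0 < t) :
    t • x ∈ interior (closedCone U) := by
  have h : (t • ·) '' interior (closedCone U) ⊆ closedCone U := by
    rintro _ ⟨z, hz, rfl⟩
    exact closedCone_smul_mem (interior_subset hz) ht.le
  exact interior_maximal h (isOpenMap_smul₀ ht.ne' _ isOpen_interior) ⟨x, hx, rfl⟩

variable {S : AddSubmonoid (Fin d → ℤ)}

theorem exists_sub_of_closure_eq_top (hS : AddSubgroup.closure (S : Set (Fin d → ℤ)) = ⊤)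
    (z : Fin d → ℤ) : ∃ f ∈ S, ∃ g ∈ S, z = f - g := by
  have hz : z ∈ AddSubgroup.closure (S : Set (Fin d → ℤ)) := hS ▸ AddSubgroup.mem_top z
  induction hz using AddSubgroup.closure_induction with
  | mem x hx => exact ⟨x, hx, 0, S.zero_mem, (sub_zero x).symm⟩
  | zero => exact ⟨0, S.zero_mem, 0, S.zero_mem, (sub_zero 0).symm⟩
  | add x y _ _ hx hy =>
    obtain ⟨f, hf, g, hg, rfl⟩ := hx
    obtain ⟨f', hf', g', hg', rfl⟩ := hy
    exact ⟨f + f', S.add_mem hf hf', g + g', S.add_mem hg hg', by abel⟩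
  | neg x _ hx =>
    obtain ⟨f, hf, g, hg, rfl⟩ := hx
    exact ⟨g, hg, f, hf, by abel⟩

/-- A semigroup that generates `ℤ^d` contains all lattice points in arbitrarily large balls
around the multiples of a suitable element. -/
theorem exists_add_nsmul_mem (hS : AddSubgroup.closure (S : Set (Fin d → ℤ)) = ⊤) :
    ∃ σ ∈ S, ∀ (L : ℕ) (z : Fin d → ℤ), (∀ i, |z i| ≤ L) → z + L • σ ∈ S := by
  choose f hf g hg hfg using fun i : Fin d => exists_sub_of_closure_eq_top hS (Pi.single i 1)
  refine ⟨∑ i, (f i + g i), S.sum_mem fun i _ => S.add_mem (hf i) (hg i), fun L z hz => ?_⟩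
  -- Each unit vector is f i - g i with both terms in S, and |z i| ≤ L keeps the coefficients L + z
  -- i and L - z i nonnegative.
  have h : z + L • ∑ i, (f i + g i) =
      ∑ i, ((L + z i).toNat • f i + (L - z i).toNat • g i) := by
    have h1 : ∀ i, (L + z i).toNat • f i + (L - z i).toNat • g i =
        z i • (Pi.single i 1 : Fin d → ℤ) + L • (f i + g i) := by
      intro i
      have h2 : ((L + z i).toNat : ℤ) = L + z i :=
        Int.toNat_of_nonneg (by linarith [(abs_le.1 (hz i)).1])
      have h3 : ((L - z i).toNat : ℤ) = L - z i :=
        Int.toNat_of_nonneg (by linarith [(abs_le.1 (hz i)).2])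
      rw [hfg i, ← natCast_zsmul, ← natCast_zsmul, ← natCast_zsmul, h2, h3]
      module
    rw [Finset.sum_congr rfl fun i _ => h1 i, Finset.smul_sum,
      Finset.sum_add_distrib (f := fun i => z i • (Pi.single i 1 : Fin d → ℤ)), add_left_inj]
    ext j
    simp [Finset.sum_apply, Pi.single_apply]
  rw [h]
  exact S.sum_mem fun i _ => S.add_mem (S.nsmul_mem (hf i) _) (S.nsmul_mem (hg i) _)

/-- The rays of the cone stay at bounded distance from the semigroup. -/
theorem exists_norm_smul_sub_le {p : EuclideanSpace ℝ (Fin d)}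
    (hp : p ∈ PointedCone.hull ℝ (latticePoint '' (S : Set (Fin d → ℤ)))) :
    ∃ M : ℝ, ∀ t : ℝ, 0 ≤ t → ∃ s ∈ S, ‖t • p - latticePoint s‖ ≤ M := by
  induction hp using Submodule.span_induction with
  | mem x hx =>
    obtain ⟨s, hs, rfl⟩ := hx
    refine ⟨‖latticePoint s‖, fun t ht => ⟨⌊t⌋₊ • s, S.nsmul_mem hs _, ?_⟩⟩
    rw [latticePoint_nsmul, ← sub_smul, norm_smul]
    refine mul_le_of_le_one_left (norm_nonneg _) ?_
    rw [Real.norm_eq_abs, abs_le]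
    constructor <;> linarith [Nat.floor_le ht, Nat.lt_floor_add_one t]
  | zero => exact ⟨0, fun t _ => ⟨0, S.zero_mem, by simp [latticePoint_zero]⟩⟩
  | add x y _ _ hx hy =>
    obtain ⟨M, hM⟩ := hx
    obtain ⟨M', hM'⟩ := hy
    refine ⟨M + M', fun t ht => ?_⟩
    obtain ⟨s, hs, h⟩ := hM t ht
    obtain ⟨s', hs', h'⟩ := hM' t ht
    refine ⟨s + s', S.add_mem hs hs', ?_⟩
    rw [latticePoint_add, smul_add, add_sub_add_comm]
    exact (norm_add_le _ _).trans (add_le_add h h')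
  | smul c x _ hx =>
    obtain ⟨M, hM⟩ := hx
    refine ⟨M, fun t ht => ?_⟩
    obtain ⟨s, hs, h⟩ := hM (t * c) (mul_nonneg ht c.2)
    exact ⟨s, hs, by rwa [mul_smul] at h⟩

/-- The lattice points that lie deep in the cone of a semigroup belong to the semigroup. -/
theorem exists_forall_mem_of_mem_interior
    (hS : AddSubgroup.closure (S : Set (Fin d → ℤ)) = ⊤) {x : EuclideanSpace ℝ (Fin d)}
    (hx : x ∈ interior (closedCone (latticePoint '' (S : Set (Fin d → ℤ))))) :
    ∃ ε > 0, ∃ T : ℝ, ∀ t ≥ T, ∀ u : Fin d → ℤ,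
      ‖latticePoint u - t • x‖ ≤ ε * t → u ∈ S := by
  obtain ⟨σ, hσ, hσS⟩ := exists_add_nsmul_mem hS
  -- Subtracting ησ creates slack: after scaling by t, about tη copies of σ are available to absorb
  -- a lattice error of norm up to tη.
  obtain ⟨η, hη, hxη⟩ : ∃ η : ℝ, 0 < η ∧ x - η • latticePoint σ ∈
      closedCone (latticePoint '' (S : Set (Fin d → ℤ))) := by
    have hc : Tendsto (fun η : ℝ => x - η • latticePoint σ) (𝓝[>] 0) (𝓝 x) := by
      have : Continuous fun η : ℝ => x - η • latticePoint σ := by fun_prop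
      simpa using (this.tendsto 0).mono_left nhdsWithin_le_nhds
    have hev : ∀ᶠ η : ℝ in 𝓝[>] 0, x - η • latticePoint σ ∈
        closedCone (latticePoint '' (S : Set (Fin d → ℤ))) :=
      hc (mem_interior_iff_mem_nhds.1 hx)
    obtain ⟨η, h1, h2⟩ := (hev.and self_mem_nhdsWithin).exists
    exact ⟨η, h2, h1⟩
  have hε : 0 < η / 4 := by positivity
  obtain ⟨p, hp, hpx⟩ := Metric.mem_closure_iff.1 hxη (η / 4) hε
  obtain ⟨M, hM⟩ := exists_norm_smul_sub_le hp
  -- The two errors of size tη/4 use up half of tη. The threshold makes the other half cover the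
  -- bounded errors M and ‖σ‖, and the 1 lost in the floor L.
  refine ⟨η / 4, hε, max 0 ((M + ‖latticePoint σ‖ + 1) / (η / 2)), fun t ht u hu => ?_⟩
  have ht0 : 0 ≤ t := (le_max_left _ _).trans ht
  have htM : M + ‖latticePoint σ‖ + 1 ≤ t * (η / 2) :=
    (div_le_iff₀ (by positivity)).1 ((le_max_right _ _).trans ht)
  obtain ⟨s, hs, hts⟩ := hM t ht0
  set L : ℕ := ⌊t * η⌋₊ with hL
  have hLle : (L : ℝ) ≤ t * η := Nat.floor_le (by positivity)
  have hLlt : t * η < L + 1 := Nat.lt_floor_add_one _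
  have hz : ‖latticePoint (u - s - L • σ)‖ ≤ L := by
    have e : latticePoint (u - s - L • σ) = (latticePoint u - t • x)
        + t • (x - η • latticePoint σ - p) + (t • p - latticePoint s)
        + (t * η - L) • latticePoint σ := by
      rw [latticePoint_sub, latticePoint_sub, latticePoint_nsmul]
      module
    have h1 : ‖t • (x - η • latticePoint σ - p)‖ ≤ t * (η / 4) := by
      rw [norm_smul, Real.norm_of_nonneg ht0, ← dist_eq_norm]
      gcongr
    have h2 : ‖(t * η - L) • latticePoint σ‖ ≤ ‖latticePoint σ‖ := by
      rw [norm_smul]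
      refine mul_le_of_le_one_left (norm_nonneg _) ?_
      rw [Real.norm_eq_abs, abs_le]
      constructor <;> linarith
    rw [e]
    refine (norm_add_le _ _).trans ?_
    have h3 := norm_add₃_le (a := latticePoint u - t • x) (b := t • (x - η • latticePoint σ - p))
      (c := t • p - latticePoint s)
    linarith
  have hmem := hσS L (u - s - L • σ) fun i => by
    have := (abs_apply_le_norm (latticePoint (u - s - L • σ)) i).trans hz
    rw [latticePoint_apply, ← Int.cast_abs, ← Int.cast_natCast] at this
    exact Int.cast_le.1 this
  have : u = s + (u - s - L • σ + L • σ) := by abel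
  rw [this]
  exact S.add_mem hs hmem

/-- The unit ball around σ is in the cone: for y in it, the floor of n(y - σ) plus nσ lies in S, and
dividing by n recovers y up to d/n. -/
theorem interior_closedCone_nonempty (hS : AddSubgroup.closure (S : Set (Fin d → ℤ)) = ⊤) :
    (interior (closedCone (latticePoint '' (S : Set (Fin d → ℤ))))).Nonempty := by
  obtain ⟨σ, hσ, hσS⟩ := exists_add_nsmul_mem hS
  refine ⟨latticePoint σ, mem_interior_iff_mem_nhds.2 (Metric.mem_nhds_iff.2
    ⟨1, one_pos, fun y hy => ?_⟩)⟩
  have hy' : ∀ i, |(y - latticePoint σ) i| ≤ 1 := fun i =>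
    (abs_apply_le_norm _ i).trans (by rw [← dist_eq_norm]; exact (Metric.mem_ball.1 hy).le)
  refine Metric.mem_closure_iff.2 fun ε hε => ?_
  obtain ⟨n, hn⟩ := exists_nat_gt (max 1 ((d : ℝ) / ε))
  have hn0 : (0 : ℝ) < n := one_pos.trans ((le_max_left _ _).trans_lt hn)
  have hnd : (d : ℝ) < n * ε := (div_lt_iff₀ hε).1 ((le_max_right _ _).trans_lt hn)
  have hmem := hσS n (floorVec n (y - latticePoint σ)) fun i => by
    have h1 := abs_le.1 (hy' i)
    rw [abs_le]
    constructor
    · refine Int.le_floor.2 ?_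
      push_cast
      nlinarith
    · have : ⌊(n : ℝ) * (y - latticePoint σ) i⌋ ≤ ⌊((n : ℤ) : ℝ)⌋ :=
        Int.floor_le_floor (by push_cast; nlinarith)
      simpa [floorVec] using this
  refine ⟨(n : ℝ)⁻¹ • latticePoint (floorVec n (y - latticePoint σ) + n • σ),
    (PointedCone.hull ℝ (latticePoint '' (S : Set (Fin d → ℤ)))).smul_mem
      (inv_nonneg.2 hn0.le) (Submodule.subset_span ⟨_, hmem, rfl⟩), ?_⟩
  have e : y - (n : ℝ)⁻¹ • latticePoint (floorVec n (y - latticePoint σ) + n • σ) =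
      -((n : ℝ)⁻¹ • (latticePoint (floorVec n (y - latticePoint σ))
        - (n : ℝ) • (y - latticePoint σ))) := by
    rw [latticePoint_add, latticePoint_nsmul, smul_add, smul_sub, smul_smul, smul_smul,
      inv_mul_cancel₀ hn0.ne']
    module
  rw [dist_eq_norm, e, norm_neg, norm_smul, Real.norm_of_nonneg (by positivity),
    inv_mul_lt_iff₀ hn0]
  exact (norm_floorVec_sub_le _ _).trans_lt hnd

/-- A set that is stable under adding interior points of a cone has negligible boundary. -/
theorem volume_closure_diff_eq_zero {U O : Set (EuclideanSpace ℝ (Fin d))} (hO : IsOpen O)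
    (hne : (interior (closedCone U)).Nonempty)
    (h : ∀ x ∈ closure O, ∀ b ∈ interior (closedCone U), x + b ∈ O) :
    volume (closure O \ O) = 0 := by
  obtain ⟨b, hb⟩ := hne
  have hmeas : MeasurableSet (closure O \ O) := isClosed_closure.measurableSet.diff hO.measurableSet
  -- Two boundary points differing by a positive multiple of b would put the further one inside O.
  -- The translates by b/(n+1) are thus disjoint, with bounded displacements.
  refine Measure.addHaar_eq_zero_of_disjoint_translates volume
    (fun n : ℕ => (1 / ((n : ℝ) + 1)) • b) ?_ ?_ hmeas
  · refine (Metric.isBounded_closedBall (x := (0 : EuclideanSpace ℝ (Fin d)))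
      (r := ‖b‖)).subset ?_
    rintro _ ⟨n, rfl⟩
    rw [mem_closedBall_zero_iff, norm_smul]
    refine mul_le_of_le_one_left (norm_nonneg _) ?_
    rw [Real.norm_of_nonneg (by positivity), div_le_one (by positivity)]
    linarith [(Nat.cast_nonneg n : (0 : ℝ) ≤ n)]
  · have key : ∀ n m : ℕ, n < m → ∀ x ∈ closure O \ O, ∀ y ∈ closure O \ O,
        (1 / ((n : ℝ) + 1)) • b + x ≠ (1 / ((m : ℝ) + 1)) • b + y := by
      intro n m hnm x hx y hy hxy
      have hpos : 0 < 1 / ((n : ℝ) + 1) - 1 / ((m : ℝ) + 1) :=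
        sub_pos.2 (Nat.one_div_lt_one_div hnm)
      refine hy.2 ?_
      have : y = x + (1 / ((n : ℝ) + 1) - 1 / ((m : ℝ) + 1)) • b := by
        rw [sub_smul, add_sub, eq_sub_iff_add_eq, add_comm y, ← hxy, add_comm]
      rw [this]
      exact h x hx.1 _ (interior_closedCone_smul_mem hb hpos)
    intro n m hnm
    rw [Function.onFun, Set.disjoint_left]
    rintro _ ⟨_, rfl, x, hx, rfl⟩ ⟨_, rfl, y, hy, hxy⟩
    rcases lt_or_gt_of_ne hnm with hlt | hlt
    · exact key n m hlt x hx y hy hxy.symm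
    · exact key m n hlt y hy x hx hxy

end SemigroupCone

/-! ### Kuratowski limits of rescaled sets of lattice points -/

section KuratowskiLimits

open scoped Pointwise

variable {d : ℕ}

/-- The lower Kuratowski limit of the sets `(1 / N n) K n`. -/
def lowerLimit (N : ℕ → ℕ) (K : ℕ → Set (Fin d → ℤ)) : Set (EuclideanSpace ℝ (Fin d)) :=
  {x | ∀ ε : ℝ, 0 < ε → ∀ᶠ n in atTop, ∃ u ∈ K n, ‖latticePoint u - (N n : ℝ) • x‖ ≤ ε * N n}

/-- The upper Kuratowski limit of the sets `(1 / N n) K n`. -/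
def upperLimit (N : ℕ → ℕ) (K : ℕ → Set (Fin d → ℤ)) : Set (EuclideanSpace ℝ (Fin d)) :=
  {x | ∀ ε : ℝ, 0 < ε → ∃ᶠ n in atTop, ∃ u ∈ K n, ‖latticePoint u - (N n : ℝ) • x‖ ≤ ε * N n}

/-- The interior of the cone of a semigroup of lattice points. -/
def openCone (S : AddSubmonoid (Fin d → ℤ)) : Set (EuclideanSpace ℝ (Fin d)) :=
  interior (closedCone (latticePoint '' (S : Set (Fin d → ℤ))))

/-- The union of the translates of the open cone of `S` by the points of the upper limit. -/
def limitRegion (S : AddSubmonoid (Fin d → ℤ)) (N : ℕ → ℕ) (K : ℕ → Set (Fin d → ℤ)) :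
    Set (EuclideanSpace ℝ (Fin d)) :=
  upperLimit N K + openCone S

variable {S : AddSubmonoid (Fin d → ℤ)} {N : ℕ → ℕ} {K : ℕ → Set (Fin d → ℤ)}

theorem isOpen_limitRegion : IsOpen (limitRegion S N K) := isOpen_interior.add_left

/-- The openness of the cone lets b absorb the small difference between x and a nearby point of the
region. -/
theorem add_mem_limitRegion_of_mem_closure {x b : EuclideanSpace ℝ (Fin d)}
    (hx : x ∈ closure (limitRegion S N K)) (hb : b ∈ openCone S) :
    x + b ∈ limitRegion S N K := by
  have hc : ContinuousAt (fun y => b + (x - y)) x := by fun_prop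
  have hev : ∀ᶠ y in 𝓝 x, b + (x - y) ∈ openCone S :=
    hc (isOpen_interior.mem_nhds (by change b + (x - x) ∈ openCone S; rwa [sub_self, add_zero]))
  obtain ⟨y, hy, hyO⟩ := mem_closure_iff_nhds.1 hx _ hev
  obtain ⟨z, hz, c, hc, rfl⟩ := hyO
  refine ⟨z, hz, c + (b + (x - (z + c))),
    interior_closedCone_add_mem (interior_subset hc) hy, ?_⟩
  simp only
  abel

theorem upperLimit_subset_closure (hS : AddSubgroup.closure (S : Set (Fin d → ℤ)) = ⊤) :
    upperLimit N K ⊆ closure (limitRegion S N K) := by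
  intro x hx
  obtain ⟨b, hb⟩ := interior_closedCone_nonempty hS
  have hc : Tendsto (fun t : ℝ => x + t • b) (𝓝[>] 0) (𝓝 x) := by
    have : Continuous fun t : ℝ => x + t • b := by fun_prop
    simpa using (this.tendsto 0).mono_left nhdsWithin_le_nhds
  refine mem_closure_of_tendsto hc ?_
  filter_upwards [self_mem_nhdsWithin] with t ht
  exact ⟨x, hx, t • b, interior_closedCone_smul_mem hb ht, rfl⟩

theorem eventually_forall_mem (hS : AddSubgroup.closure (S : Set (Fin d → ℤ)) = ⊤)
    (hN : Tendsto N atTop atTop) {x : EuclideanSpace ℝ (Fin d)} (hx : x ∈ openCone S) :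
    ∃ ε : ℝ, 0 < ε ∧ ∀ᶠ n in atTop, ∀ u : Fin d → ℤ,
      ‖latticePoint u - (N n : ℝ) • x‖ ≤ ε * N n → u ∈ S := by
  obtain ⟨ε, hε, T, hT⟩ := exists_forall_mem_of_mem_interior hS hx
  refine ⟨ε, hε, ?_⟩
  filter_upwards [(tendsto_natCast_atTop_atTop.comp hN).eventually_ge_atTop T] with n hn u hu
  exact hT _ hn u hu

/-- For x = y + c, the equality of the limits supplies a point k of K n near N n • y at every late
scale. If u is near N n • x, then u - k is near N n • c, hence in S, and K n is stable under S. -/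
theorem eventually_forall_mem_of_mem_limitRegion
    (hS : AddSubgroup.closure (S : Set (Fin d → ℤ)) = ⊤) (hN : Tendsto N atTop atTop)
    (hK : ∀ n, ∀ u ∈ K n, ∀ s ∈ S, u + s ∈ K n) (hlim : upperLimit N K ⊆ lowerLimit N K)
    {x : EuclideanSpace ℝ (Fin d)} (hx : x ∈ limitRegion S N K) :
    ∃ ε : ℝ, 0 < ε ∧ ∀ᶠ n in atTop, ∀ u : Fin d → ℤ,
      ‖latticePoint u - (N n : ℝ) • x‖ ≤ ε * N n → u ∈ K n := by
  obtain ⟨y, hy, c, hc, rfl⟩ := hx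
  obtain ⟨ε, hε, h⟩ := eventually_forall_mem hS hN hc
  refine ⟨ε / 2, by positivity, ?_⟩
  filter_upwards [h, hlim hy (ε / 2) (by positivity)] with n hn hn' u hu
  obtain ⟨k, hk, hky⟩ := hn'
  have hs : u - k ∈ S := by
    refine hn _ ?_
    have e : latticePoint (u - k) - (N n : ℝ) • c =
        (latticePoint u - (N n : ℝ) • (y + c)) - (latticePoint k - (N n : ℝ) • y) := by
      rw [latticePoint_sub]; module
    rw [e]
    exact (norm_sub_le _ _).trans ((add_le_add hu hky).trans (by linarith))
  simpa using hK n k hk _ hs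

theorem eventually_forall_not_mem_of_not_mem_closure
    (hS : AddSubgroup.closure (S : Set (Fin d → ℤ)) = ⊤)
    {x : EuclideanSpace ℝ (Fin d)} (hx : x ∉ closure (limitRegion S N K)) :
    ∃ ε : ℝ, 0 < ε ∧ ∀ᶠ n in atTop, ∀ u : Fin d → ℤ,
      ‖latticePoint u - (N n : ℝ) • x‖ ≤ ε * N n → u ∉ K n := by
  have h : x ∉ upperLimit N K := fun h => hx (upperLimit_subset_closure hS h)
  simp only [upperLimit, Set.mem_ofPred_eq, not_forall, not_frequently] at h
  obtain ⟨ε, hε, h⟩ := h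
  refine ⟨ε, hε, ?_⟩
  filter_upwards [h] with n hn u hu huK
  exact hn ⟨u, huK, hu⟩

theorem eventually_norm_floorVec_sub_le (hN : Tendsto N atTop atTop) (w : Fin d → ℤ)
    (x : EuclideanSpace ℝ (Fin d)) {ε : ℝ} (hε : 0 < ε) :
    ∀ᶠ n in atTop, ‖latticePoint (floorVec (N n) x - w) - (N n : ℝ) • x‖ ≤ ε * N n := by
  filter_upwards [(tendsto_natCast_atTop_atTop.comp hN).eventually_ge_atTop
    ((d + ‖latticePoint w‖) / ε)] with n hn
  rw [div_le_iff₀' hε] at hn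
  refine le_trans ?_ hn
  rw [latticePoint_sub, sub_right_comm]
  exact (norm_sub_le _ _).trans (add_le_add_left (norm_floorVec_sub_le _ _) _)

/-- Almost every point of the cone lies either in the limit region or outside its closure, and
the rescaled complements of the sets `K n` converge almost everywhere. -/
theorem ae_eventually_floorVec_mem_iff
    (hS : AddSubgroup.closure (S : Set (Fin d → ℤ)) = ⊤) (hN : Tendsto N atTop atTop)
    (hK : ∀ n, ∀ u ∈ K n, ∀ s ∈ S, u + s ∈ K n) (hlim : upperLimit N K ⊆ lowerLimit N K)
    (w w' : Fin d → ℤ) :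
    ∀ᵐ x, ∀ᶠ n in atTop, floorVec (N n) x ∈ {u | u - w ∈ S ∧ u - w' ∉ K n} ↔
      x ∈ openCone S \ closure (limitRegion S N K) := by
  have h1 : ∀ᵐ x, x ∉ frontier (closedCone (latticePoint '' (S : Set (Fin d → ℤ)))) :=
    measure_eq_zero_iff_ae_notMem.1 ((convex_closedCone _).addHaar_frontier volume)
  have h2 : ∀ᵐ x, x ∉ closure (limitRegion S N K) \ limitRegion S N K :=
    measure_eq_zero_iff_ae_notMem.1 (volume_closure_diff_eq_zero isOpen_limitRegion
      (interior_closedCone_nonempty hS) fun x hx b hb => add_mem_limitRegion_of_mem_closure hx hb)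
  filter_upwards [h1, h2] with x hx1 hx2
  by_cases hxC : x ∈ closedCone (latticePoint '' (S : Set (Fin d → ℤ)))
  · have hxi : x ∈ openCone S := by
      by_contra h
      exact hx1 ⟨subset_closure hxC, h⟩
    by_cases hxO : x ∈ closure (limitRegion S N K)
    · have hxO' : x ∈ limitRegion S N K := by
        by_contra h
        exact hx2 ⟨hxO, h⟩
      obtain ⟨ε, hε, h⟩ := eventually_forall_mem_of_mem_limitRegion hS hN hK hlim hxO'
      filter_upwards [h, eventually_norm_floorVec_sub_le hN w' x hε] with n hn hn'
      exact ⟨fun h => absurd (hn _ hn') h.2, fun h => absurd hxO h.2⟩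
    · obtain ⟨ε, hε, h⟩ := eventually_forall_not_mem_of_not_mem_closure hS hxO
      obtain ⟨ε', hε', h'⟩ := eventually_forall_mem hS hN hxi
      filter_upwards [h, h', eventually_norm_floorVec_sub_le hN w' x hε,
        eventually_norm_floorVec_sub_le hN w x hε'] with n hn hn' hw' hw
      exact ⟨fun _ => ⟨hxi, hxO⟩, fun _ => ⟨hn' _ hw, hn _ hw'⟩⟩
  · obtain ⟨ε, hε, h⟩ := Metric.isOpen_iff.1
      (isClosed_closure (s := (PointedCone.hull ℝ (latticePoint '' (S : Set (Fin d → ℤ))) :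
        Set (EuclideanSpace ℝ (Fin d))))).isOpen_compl x hxC
    filter_upwards [eventually_norm_floorVec_sub_le hN w x (half_pos hε),
      hN.eventually_gt_atTop 0] with n hn hn0
    have hn0' : (0 : ℝ) < N n := by exact_mod_cast hn0
    refine ⟨fun hu => ?_, fun h => absurd (interior_subset h.1) hxC⟩
    -- Rescaling a lattice point of S gives a point of the closed cone, which cannot be close to a
    -- point outside it.
    have hmem := closedCone_smul_mem (subset_closedCone _ (Set.mem_image_of_mem latticePoint hu.1))
      (inv_nonneg.2 hn0'.le)
    refine absurd hmem (h ?_)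
    have e : (N n : ℝ)⁻¹ • latticePoint (floorVec (N n) x - w) - x =
        (N n : ℝ)⁻¹ • (latticePoint (floorVec (N n) x - w) - (N n : ℝ) • x) := by
      rw [smul_sub, smul_smul, inv_mul_cancel₀ hn0'.ne', one_smul]
    rw [Metric.mem_ball, dist_eq_norm, e, norm_smul, Real.norm_of_nonneg (by positivity),
      inv_mul_lt_iff₀ hn0']
    nlinarith

/-- If every point of `K m` is followed, at all later scales, by points of `K n` at distance
`O(1 / N m)`, then the Kuratowski limits agree. -/
theorem upperLimit_subset_lowerLimit_of_forward (hN : Tendsto N atTop atTop) (M : ℝ)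
    (h : ∀ m, 0 < N m → ∀ u ∈ K m, ∀ δ : ℝ, 0 < δ → ∀ᶠ n in atTop, ∃ k ∈ K n,
      ‖latticePoint k - ((N n : ℝ) / N m) • latticePoint u‖ ≤ (M / N m + δ) * N n) :
    upperLimit N K ⊆ lowerLimit N K := by
  intro x hx ε hε
  have h3 : 0 < ε / 3 := by positivity
  -- One index m suffices, chosen late enough that the propagation error M / N m is below ε/3.
  obtain ⟨m, ⟨u, hu, hux⟩, hm0, hmM⟩ := ((hx (ε / 3) h3).and_eventually
    ((hN.eventually_gt_atTop 0).and ((tendsto_natCast_atTop_atTop.comp hN).eventually_ge_atTop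
      (M / (ε / 3))))).exists
  have hm0' : (0 : ℝ) < N m := by exact_mod_cast hm0
  have hM : M / N m ≤ ε / 3 := by
    rw [div_le_iff₀ hm0']
    exact (div_le_iff₀' h3).1 hmM
  filter_upwards [h m hm0 u hu (ε / 3) h3] with n ⟨k, hk, hku⟩
  refine ⟨k, hk, ?_⟩
  have e : latticePoint k - (N n : ℝ) • x =
      (latticePoint k - ((N n : ℝ) / N m) • latticePoint u) +
        ((N n : ℝ) / N m) • (latticePoint u - (N m : ℝ) • x) := by
    rw [smul_sub, smul_smul, div_mul_cancel₀ _ hm0'.ne']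
    abel
  have h4 : ‖((N n : ℝ) / N m) • (latticePoint u - (N m : ℝ) • x)‖ ≤ ε / 3 * N n := by
    rw [norm_smul, Real.norm_of_nonneg (by positivity), div_mul_eq_mul_div, div_le_iff₀ hm0']
    calc (N n : ℝ) * _ ≤ N n * (ε / 3 * N m) := by gcongr
      _ = _ := by ring
  have h5 : (M / N m + ε / 3) * N n ≤ (ε / 3 + ε / 3) * N n := by gcongr
  rw [e]
  refine (norm_add_le _ _).trans ?_
  linarith

/-- If every point of `K m` is preceded, at all earlier scales, by points of `K n` at distance
`O(1 / N n)`, then the Kuratowski limits agree. -/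
theorem upperLimit_subset_lowerLimit_of_backward (hN : Tendsto N atTop atTop) (M : ℝ)
    (h : ∀ n m, n ≤ m → 0 < N m → ∀ u ∈ K m, ∃ k ∈ K n,
      ‖latticePoint k - ((N n : ℝ) / N m) • latticePoint u‖ ≤ M) :
    upperLimit N K ⊆ lowerLimit N K := by
  intro x hx ε hε
  have h2 : 0 < ε / 2 := by positivity
  filter_upwards [(tendsto_natCast_atTop_atTop.comp hN).eventually_ge_atTop (M / (ε / 2))]
    with n hn
  -- With n fixed, the approximation is taken at a later scale m ≥ n and pulled back to n.
  obtain ⟨m, ⟨u, hu, hux⟩, hm0, hnm⟩ := ((hx (ε / 2) h2).and_eventually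
    ((hN.eventually_gt_atTop 0).and (eventually_ge_atTop n))).exists
  have hm0' : (0 : ℝ) < N m := by exact_mod_cast hm0
  obtain ⟨k, hk, hku⟩ := h n m hnm hm0 u hu
  refine ⟨k, hk, ?_⟩
  have hM : M ≤ ε / 2 * N n := (div_le_iff₀' h2).1 hn
  have e : latticePoint k - (N n : ℝ) • x =
      (latticePoint k - ((N n : ℝ) / N m) • latticePoint u) +
        ((N n : ℝ) / N m) • (latticePoint u - (N m : ℝ) • x) := by
    rw [smul_sub, smul_smul, div_mul_cancel₀ _ hm0'.ne']
    abel
  have h4 : ‖((N n : ℝ) / N m) • (latticePoint u - (N m : ℝ) • x)‖ ≤ ε / 2 * N n := by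
    rw [norm_smul, Real.norm_of_nonneg (by positivity), div_mul_eq_mul_div, div_le_iff₀ hm0']
    calc (N n : ℝ) * _ ≤ N n * (ε / 2 * N m) := by gcongr
      _ = _ := by ring
  rw [e]
  refine (norm_add_le _ _).trans ?_
  linarith

end KuratowskiLimits

/-! ### Lengths of quotients along a filtration step -/

section FiltrationStep

variable {R : Type*} [CommRing R] {I J J' : Ideal R} {W : Type*} [AddCommGroup W] [Module R W]

theorem length_quotient_eq_add_of_le {T T' : Ideal R} (h : T' ≤ T) :
    Module.length R (R ⧸ T') =
      Module.length R (Submodule.map T'.mkQ T) + Module.length R (R ⧸ T) := by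
  rw [Module.length_eq_add_of_exact (Submodule.map T'.mkQ T).subtype
    (Submodule.map T'.mkQ T).mkQ (Submodule.subtype_injective _) (Submodule.mkQ_surjective _)
    (LinearMap.exact_subtype_mkQ _),
    (Submodule.quotientQuotientEquivQuotient T' T h).length_eq]

theorem length_quotient_mono {T T' : Ideal R} (h : T' ≤ T) :
    Module.length R (R ⧸ T) ≤ Module.length R (R ⧸ T') := by
  rw [length_quotient_eq_add_of_le h]
  exact le_add_self

theorem map_mkQ_sup_eq :
    Submodule.map (I ⊔ J').mkQ (I ⊔ J) = Submodule.map (I ⊔ J').mkQ J := by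
  refine le_antisymm ?_ (Submodule.map_mono le_sup_right)
  rw [Submodule.map_sup]
  refine sup_le ?_ le_rfl
  rintro _ ⟨x, hx, rfl⟩
  have : (I ⊔ J').mkQ x = 0 := (Submodule.Quotient.mk_eq_zero _).2 (Ideal.mem_sup_left hx)
  rw [this]
  exact Submodule.zero_mem _

/-- The module (I + J)/(I + J') is a quotient of J in which ker f ⊆ J' dies, so it is a quotient of
the image of f. -/
theorem length_quotient_sup_le (hJ : J' ≤ J) (f : J →ₗ[R] W)
    (hf : ∀ x : J, f x = 0 → (x : R) ∈ J') :
    Module.length R (R ⧸ (I ⊔ J')) ≤ Module.length R (R ⧸ (I ⊔ J)) + Module.length R W := by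
  rw [length_quotient_eq_add_of_le (sup_le_sup_left hJ I), map_mkQ_sup_eq, add_comm]
  gcongr
  let g : J →ₗ[R] Submodule.map (I ⊔ J').mkQ J := (I ⊔ J').mkQ.submoduleMap J
  have hker : LinearMap.ker f ≤ LinearMap.ker g := by
    intro x hx
    rw [LinearMap.mem_ker]
    refine Subtype.ext ?_
    exact (Submodule.Quotient.mk_eq_zero _).2 (Ideal.mem_sup_right (hf x hx))
  calc Module.length R (Submodule.map (I ⊔ J').mkQ J)
      ≤ Module.length R (J ⧸ LinearMap.ker f) :=
        Module.length_le_of_surjective (Submodule.liftQ _ g hker) (by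
          rw [← LinearMap.range_eq_top, Submodule.range_liftQ, LinearMap.range_eq_top]
          exact LinearMap.submoduleMap_surjective _ _)
    _ = Module.length R (LinearMap.range f) := f.quotKerEquivRange.length_eq
    _ ≤ Module.length R W := Module.length_le_of_injective _ (Submodule.subtype_injective _)

/-- If x ∈ J dies modulo I + J', write x = i + j; then i ∈ I ∩ J ⊆ J', so x ∈ J' and f x = 0. Hence
W is a quotient of (I + J)/(I + J'). -/
theorem le_length_quotient_sup (hJ : J' ≤ J) (f : J →ₗ[R] W) (hsurj : Function.Surjective f)
    (hf : ∀ x : J, (x : R) ∈ J' → f x = 0) (hI : I ⊓ J ≤ J') :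
    Module.length R (R ⧸ (I ⊔ J)) + Module.length R W ≤ Module.length R (R ⧸ (I ⊔ J')) := by
  rw [length_quotient_eq_add_of_le (sup_le_sup_left hJ I), map_mkQ_sup_eq,
    add_comm (Module.length R (Submodule.map _ _))]
  gcongr
  let g : J →ₗ[R] Submodule.map (I ⊔ J').mkQ J := (I ⊔ J').mkQ.submoduleMap J
  have hker : LinearMap.ker g ≤ LinearMap.ker f := by
    intro x hx
    have h : (x : R) ∈ I ⊔ J' :=
      (Submodule.Quotient.mk_eq_zero _).1 (congrArg Subtype.val (LinearMap.mem_ker.1 hx))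
    obtain ⟨i, hi, j, hj, hij⟩ := Submodule.mem_sup.1 h
    refine hf x ?_
    have : i ∈ J := by
      rw [← eq_sub_iff_add_eq] at hij
      rw [hij]
      exact J.sub_mem x.2 (hJ hj)
    rw [← hij]
    exact J'.add_mem (hI ⟨hi, this⟩) hj
  calc Module.length R W ≤ Module.length R (J ⧸ LinearMap.ker g) :=
        Module.length_le_of_surjective (Submodule.liftQ _ f hker) (by
          rw [← LinearMap.range_eq_top, Submodule.range_liftQ, LinearMap.range_eq_top]
          exact hsurj)
    _ = Module.length R (LinearMap.range g) := g.quotKerEquivRange.length_eq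
    _ ≤ _ := Module.length_le_of_injective _ (Submodule.subtype_injective _)

end FiltrationStep

/-! ### The filtration of a dominated ring by values -/

section ValueFiltration

variable {d : ℕ} {a : EuclideanSpace ℝ (Fin d)} {ha : LinearIndependent ℚ (fun i => a i)}
variable {R : Type*} [CommRing R] {F : Type*} [Field F] [Algebra R F]
variable {ν : AddValuation F (WithTop (OrdLattice a ha))}

theorem exists_map_eq_coe {x : F} (hx : x ≠ 0) :
    ∃ u : OrdLattice a ha, ν x = (u : WithTop (OrdLattice a ha)) := by
  obtain ⟨u, hu⟩ := WithTop.ne_top_iff_exists.1 (mt (AddValuation.top_iff ν).1 hx)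
  exact ⟨u, hu.symm⟩

theorem ne_zero_of_map_eq_coe {x : F} {u : OrdLattice a ha}
    (h : ν x = (u : WithTop (OrdLattice a ha))) : x ≠ 0 := by
  rintro rfl
  rw [AddValuation.map_zero] at h
  exact WithTop.top_ne_coe h

theorem le_map_iff_nonneg_map_div {t x : F} {u : OrdLattice a ha}
    (ht : ν t = (u : WithTop (OrdLattice a ha))) :
    (u : WithTop (OrdLattice a ha)) ≤ ν x ↔ 0 ≤ ν (x / t) := by
  have h : ν x = ν (x / t) + u := by
    rw [← ht, ← AddValuation.map_mul, div_mul_cancel₀ _ (ne_zero_of_map_eq_coe ht)]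
  rw [h]
  by_cases hx : x / t = 0
  · simp [hx]
  · obtain ⟨v, hv⟩ := exists_map_eq_coe (ν := ν) hx
    rw [hv]
    norm_cast
    exact le_add_iff_nonneg_left u

theorem lt_map_iff_pos_map_div {t x : F} {u : OrdLattice a ha}
    (ht : ν t = (u : WithTop (OrdLattice a ha))) :
    (u : WithTop (OrdLattice a ha)) < ν x ↔ 0 < ν (x / t) := by
  have h : ν x = ν (x / t) + u := by
    rw [← ht, ← AddValuation.map_mul, div_mul_cancel₀ _ (ne_zero_of_map_eq_coe ht)]
  rw [h]
  by_cases hx : x / t = 0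
  · simp [hx]
  · obtain ⟨v, hv⟩ := exists_map_eq_coe (ν := ν) hx
    rw [hv]
    norm_cast
    exact lt_add_iff_pos_left u

theorem valueSemigroup_add_valueSet {I : Ideal R} {u v : OrdLattice a ha} (hu : u ∈ valueSet ν I)
    (hv : v ∈ valueSemigroup R ν) : u + v ∈ valueSet ν I := by
  obtain ⟨x, hx, hxu⟩ := hu
  obtain ⟨y, -, hyv⟩ := hv
  refine ⟨x * y, I.mul_mem_right _ hx, ?_⟩
  rw [map_mul, AddValuation.map_mul, hxu, hyv]
  rfl

/-- Induction on the number of values below t: the threshold drops to the largest such value, so the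
filtration is traversed one jump at a time. -/
theorem threshold_induction (hfin : ∀ t : OrdLattice a ha, {u ∈ valueSemigroup R ν | u < t}.Finite)
    {P : OrdLattice a ha → Prop}
    (base : ∀ t, (∀ u ∈ valueSemigroup R ν, t ≤ u) → P t)
    (step : ∀ t, ∀ u ∈ valueSemigroup R ν, u < t →
      (∀ v ∈ valueSemigroup R ν, v < t → v ≤ u) → P u → P t) (t : OrdLattice a ha) : P t := by
  induction hn : {u ∈ valueSemigroup R ν | u < t}.ncard using Nat.strong_induction_on
    generalizing t with
  | _ n ih =>
    by_cases hne : {u ∈ valueSemigroup R ν | u < t}.Nonempty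
    · obtain ⟨u, ⟨huS, hut⟩, hmax⟩ := (hfin t).exists_maximal hne
      refine step t u huS hut (fun v hv hvt => ?_) (ih _ ?_ u rfl)
      · rcases le_total v u with h | h
        · exact h
        · exact hmax ⟨hv, hvt⟩ h
      · rw [← hn]
        refine Set.ncard_lt_ncard ⟨fun v hv => ⟨hv.1, hv.2.trans hut⟩, fun hsub => ?_⟩ (hfin t)
        exact lt_irrefl _ (hsub ⟨huS, hut⟩).2
    · refine base t fun u hu => ?_
      by_contra hlt
      exact hne ⟨u, hu, not_le.1 hlt⟩

variable [IsLocalRing R]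

/-- The elements of `R` of value at least `u`. -/
def valueIdeal (h : IsDominatedBy R ν) (u : OrdLattice a ha) : Ideal R where
  carrier := {r | (u : WithTop (OrdLattice a ha)) ≤ ν (algebraMap R F r)}
  add_mem' {x y} hx hy := by
    simp only [Set.mem_ofPred_eq, map_add] at *
    exact AddValuation.map_le_add ν hx hy
  zero_mem' := by simp
  smul_mem' c x hx := by
    simp only [Set.mem_ofPred_eq, smul_eq_mul, map_mul, AddValuation.map_mul] at *
    exact hx.trans (le_add_of_nonneg_left (h.nonneg c))

/-- The elements of `R` of value greater than `u`. -/
def valueIdealLT (h : IsDominatedBy R ν) (u : OrdLattice a ha) : Ideal R where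
  carrier := {r | (u : WithTop (OrdLattice a ha)) < ν (algebraMap R F r)}
  add_mem' {x y} hx hy := by
    simp only [Set.mem_ofPred_eq, map_add] at *
    exact AddValuation.map_lt_add ν hx hy
  zero_mem' := by simp
  smul_mem' c x hx := by
    simp only [Set.mem_ofPred_eq, smul_eq_mul, map_mul, AddValuation.map_mul] at *
    exact hx.trans_le (le_add_of_nonneg_left (h.nonneg c))

theorem mem_valueIdeal (h : IsDominatedBy R ν) {u : OrdLattice a ha} {r : R} :
    r ∈ valueIdeal h u ↔ (u : WithTop (OrdLattice a ha)) ≤ ν (algebraMap R F r) := Iff.rfl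

theorem mem_valueIdealLT (h : IsDominatedBy R ν) {u : OrdLattice a ha} {r : R} :
    r ∈ valueIdealLT h u ↔ (u : WithTop (OrdLattice a ha)) < ν (algebraMap R F r) := Iff.rfl

theorem valueIdealLT_le (h : IsDominatedBy R ν) (u : OrdLattice a ha) :
    valueIdealLT h u ≤ valueIdeal h u := fun _ hr => ((mem_valueIdealLT h).1 hr).le

theorem residue_eq_zero_iff_pos (x : valuationRing ν) :
    IsLocalRing.residue (valuationRing ν) x = 0 ↔ 0 < ν (x : F) := by
  rw [IsLocalRing.residue_eq_zero_iff, IsLocalRing.mem_maximalIdeal, mem_nonunits_iff]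
  have hx : 0 ≤ ν (x : F) := (mem_valuationRing ν _).1 x.2
  constructor
  · intro h
    refine lt_of_le_of_ne hx fun h0 => h ?_
    have hx0 : (x : F) ≠ 0 := by
      intro hx0
      rw [hx0, AddValuation.map_zero] at h0
      exact WithTop.zero_ne_top h0
    have hinv : ν (x : F)⁻¹ = 0 := by
      have := AddValuation.map_mul ν (x : F) (x : F)⁻¹
      rwa [mul_inv_cancel₀ hx0, AddValuation.map_one, ← h0, zero_add, eq_comm] at this
    refine IsUnit.of_mul_eq_one ⟨(x : F)⁻¹, (mem_valuationRing ν _).2 hinv.ge⟩ ?_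
    exact Subtype.ext (mul_inv_cancel₀ hx0)
  · intro h hu
    obtain ⟨y, hy⟩ := hu.exists_right_inv
    have h1 : (x : F) * (y : F) = 1 := congrArg Subtype.val hy
    have h2 : ν (x : F) + ν (y : F) = 0 := by
      rw [← AddValuation.map_mul, h1, AddValuation.map_one]
    exact absurd h2 (add_pos_of_pos_of_nonneg h ((mem_valuationRing ν _).1 y.2)).ne'

/-- Leading forms, as a map to the residue field. -/
theorem exists_leadingForm (h : IsDominatedBy R ν) {t : F} {u : OrdLattice a ha}
    (ht : ν t = (u : WithTop (OrdLattice a ha))) :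
    letI : Module R (residueFieldOf ν) :=
      Module.compHom _ ((IsLocalRing.residue (valuationRing ν)).comp (toValuationRing h))
    ∃ f : valueIdeal h u →ₗ[R] residueFieldOf ν, ∀ (x : valueIdeal h u)
      (hx : algebraMap R F x / t ∈ valuationRing ν),
        f x = IsLocalRing.residue (valuationRing ν) ⟨algebraMap R F x / t, hx⟩ := by
  let _ : Module R (residueFieldOf ν) :=
    Module.compHom _ ((IsLocalRing.residue (valuationRing ν)).comp (toValuationRing h))
  have hmem : ∀ x : valueIdeal h u, algebraMap R F x / t ∈ valuationRing ν := fun x =>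
    (mem_valuationRing ν _).2 ((le_map_iff_nonneg_map_div ht).1 x.2)
  refine ⟨{ toFun := fun x => IsLocalRing.residue (valuationRing ν) ⟨_, hmem x⟩
            map_add' := fun x y => ?_
            map_smul' := fun c x => ?_ }, fun x hx => rfl⟩
  · rw [← map_add]
    congr 1
    refine Subtype.ext ?_
    change algebraMap R F (x + y : R) / t = algebraMap R F x / t + algebraMap R F y / t
    rw [map_add, add_div]
  · change _ = IsLocalRing.residue (valuationRing ν) (toValuationRing h c) * _
    rw [← map_mul]
    congr 1
    refine Subtype.ext ?_
    change algebraMap R F (c * x : R) / t = algebraMap R F c * (algebraMap R F x / t)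
    rw [map_mul, mul_div_assoc]

theorem length_residueFieldOf (h : IsDominatedBy R ν) (hfin : (residueExtension h).Finite) :
    letI : Module R (residueFieldOf ν) :=
      Module.compHom _ ((IsLocalRing.residue (valuationRing ν)).comp (toValuationRing h))
    Module.length R (residueFieldOf ν) = residueDegree h := by
  let _ : Module R (residueFieldOf ν) :=
    Module.compHom _ ((IsLocalRing.residue (valuationRing ν)).comp (toValuationRing h))
  let _ : Algebra (IsLocalRing.ResidueField R) (residueFieldOf ν) :=
    (residueExtension h).toAlgebra
  have : Module.Finite (IsLocalRing.ResidueField R) (residueFieldOf ν) := hfin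
  have : IsScalarTower R (IsLocalRing.ResidueField R) (residueFieldOf ν) :=
    IsScalarTower.of_algebraMap_smul fun r x => rfl
  rw [Module.length_eq_of_surjective (R := IsLocalRing.ResidueField R)
    (IsLocalRing.residue_surjective (R := R)), Module.length_eq_finrank]
  rfl

/-- After a bounded shift of the value, all elements of `F` can be approximated by elements of
an ideal. -/
theorem exists_shift [IsFractionRing R F] (h : IsDominatedBy R ν) (hfin : (residueExtension h).Finite) :
    ∃ w ∈ valueSemigroup R ν, ∀ (I : Ideal R), ∀ u ∈ valueSet ν I, ∀ y : F,
      ((u + w : OrdLattice a ha) : WithTop (OrdLattice a ha)) ≤ ν y →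
        ∃ x ∈ I, ((u + w : OrdLattice a ha) : WithTop (OrdLattice a ha)) <
          ν (y - algebraMap R F x) := by
  classical
  let _ : Algebra (IsLocalRing.ResidueField R) (residueFieldOf ν) :=
    (residueExtension h).toAlgebra
  have : Module.Finite (IsLocalRing.ResidueField R) (residueFieldOf ν) := hfin
  obtain ⟨s, hs⟩ := Module.Finite.fg_top (R := IsLocalRing.ResidueField R)
    (M := residueFieldOf ν)
  choose l hl using IsLocalRing.residue_surjective (R := valuationRing ν)
  -- The lifts l κ of generators of 𝕜_ν lie only in F. Multiplication by b brings them into R, and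
  -- the price is the shift w = ν b.
  obtain ⟨b, hb⟩ := IsLocalization.exist_integer_multiples_of_finset (nonZeroDivisors R)
    (s.image fun κ => (l κ : F))
  have hb' : ∀ κ ∈ s, ∃ A : R, algebraMap R F A = algebraMap R F b * (l κ : F) := by
    intro κ hκ
    obtain ⟨A, hA⟩ := hb _ (Finset.mem_image_of_mem _ hκ)
    exact ⟨A, by rw [hA, Algebra.smul_def]⟩
  choose! A hA using hb'
  have hb0 : algebraMap R F b ≠ 0 :=
    IsFractionRing.to_map_ne_zero_of_mem_nonZeroDivisors b.2
  obtain ⟨w, hw⟩ := exists_map_eq_coe (ν := ν) hb0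
  refine ⟨w, ⟨b, Submodule.mem_top, hw⟩, ?_⟩
  rintro I u ⟨r, hrI, hr⟩ y hy
  have ht : ν (algebraMap R F r * algebraMap R F b) =
      ((u + w : OrdLattice a ha) : WithTop (OrdLattice a ha)) := by
    rw [AddValuation.map_mul, hr, hw]; rfl
  have hyV := (mem_valuationRing ν _).2 ((le_map_iff_nonneg_map_div ht).1 hy)
  have hspan : IsLocalRing.residue (valuationRing ν) ⟨_, hyV⟩ ∈
      Submodule.span (IsLocalRing.ResidueField R) (s : Set (residueFieldOf ν)) := by
    rw [hs]; exact Submodule.mem_top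
  obtain ⟨c, -, hc⟩ := Submodule.mem_span_finset.1 hspan
  choose t ht' using fun κ => IsLocalRing.residue_surjective (R := R) (c κ)
  -- The residue of y/(rb) is ∑ c κ • κ. Lifting c κ to t κ ∈ R and using A κ = b · l κ gives an
  -- element of I with the same leading form as y.
  refine ⟨∑ κ ∈ s, t κ * A κ * r, I.sum_mem fun κ _ => I.mul_mem_left _ hrI, ?_⟩
  rw [lt_map_iff_pos_map_div ht]
  have hr0 : algebraMap R F r ≠ 0 := ne_zero_of_map_eq_coe hr
  have e : (y - algebraMap R F (∑ κ ∈ s, t κ * A κ * r)) /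
      (algebraMap R F r * algebraMap R F b) =
      ((⟨_, hyV⟩ - ∑ κ ∈ s, toValuationRing h (t κ) * l κ : valuationRing ν) : F) := by
    have e1 : ((⟨_, hyV⟩ - ∑ κ ∈ s, toValuationRing h (t κ) * l κ : valuationRing ν) : F) =
        y / (algebraMap R F r * algebraMap R F b) -
          ∑ κ ∈ s, algebraMap R F (t κ) * (l κ : F) := by
      push_cast
      rfl
    rw [e1, sub_div]
    congr 1
    rw [map_sum, Finset.sum_div]
    refine Finset.sum_congr rfl fun κ hκ => ?_
    rw [map_mul, map_mul, hA κ hκ]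
    field_simp
  rw [e, ← residue_eq_zero_iff_pos, map_sub, map_sum, ← hc, sub_eq_zero]
  refine Finset.sum_congr rfl fun κ _ => ?_
  rw [map_mul, hl, ← ht']
  rfl

/-- Dividing by an element of value u and taking residues kills exactly the elements of larger
value, so each jump is a subquotient of 𝕜_ν. -/
theorem length_quotient_sup_valueIdealLT_le (h : IsDominatedBy R ν)
    (hfin : (residueExtension h).Finite)
    (hsurj : ∀ u : OrdLattice a ha, ∃ x : F, ν x = (u : WithTop (OrdLattice a ha)))
    (I : Ideal R) (u : OrdLattice a ha) :
    Module.length R (R ⧸ (I ⊔ valueIdealLT h u)) ≤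
      Module.length R (R ⧸ (I ⊔ valueIdeal h u)) + residueDegree h := by
  let _ : Module R (residueFieldOf ν) :=
    Module.compHom _ ((IsLocalRing.residue (valuationRing ν)).comp (toValuationRing h))
  obtain ⟨t, ht⟩ := hsurj u
  obtain ⟨f, hf⟩ := exists_leadingForm h ht
  rw [← length_residueFieldOf h hfin]
  refine length_quotient_sup_le (valueIdealLT_le h u) f fun x hx => ?_
  have hmem : algebraMap R F x / t ∈ valuationRing ν :=
    (mem_valuationRing ν _).2 ((le_map_iff_nonneg_map_div ht).1 x.2)
  rw [hf x hmem, residue_eq_zero_iff_pos] at hx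
  exact (lt_map_iff_pos_map_div ht).2 hx

/-- The approximation hypothesis makes the leading form map onto 𝕜_ν, and u ∉ ν(I) forces I ∩ {ν ≥
u} into {ν > u}, so nothing of the jump is lost to I. -/
theorem le_length_quotient_sup_valueIdealLT (h : IsDominatedBy R ν)
    (hfin : (residueExtension h).Finite)
    (hsurj : ∀ u : OrdLattice a ha, ∃ x : F, ν x = (u : WithTop (OrdLattice a ha)))
    {u : OrdLattice a ha}
    (happrox : ∀ y : F, (u : WithTop (OrdLattice a ha)) ≤ ν y →
      ∃ x : R, (u : WithTop (OrdLattice a ha)) < ν (y - algebraMap R F x))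
    {I : Ideal R} (hI : u ∉ valueSet ν I) :
    Module.length R (R ⧸ (I ⊔ valueIdeal h u)) + residueDegree h ≤
      Module.length R (R ⧸ (I ⊔ valueIdealLT h u)) := by
  let _ : Module R (residueFieldOf ν) :=
    Module.compHom _ ((IsLocalRing.residue (valuationRing ν)).comp (toValuationRing h))
  obtain ⟨t, ht⟩ := hsurj u
  obtain ⟨f, hf⟩ := exists_leadingForm h ht
  have hmem : ∀ x : valueIdeal h u, algebraMap R F x / t ∈ valuationRing ν := fun x =>
    (mem_valuationRing ν _).2 ((le_map_iff_nonneg_map_div ht).1 x.2)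
  have ht0 : t ≠ 0 := ne_zero_of_map_eq_coe ht
  rw [← length_residueFieldOf h hfin]
  refine le_length_quotient_sup (valueIdealLT_le h u) f ?_ ?_ ?_
  · intro κ
    obtain ⟨⟨z, hz⟩, rfl⟩ := IsLocalRing.residue_surjective κ
    have hz' : 0 ≤ ν z := (mem_valuationRing ν _).1 hz
    have hzt : (u : WithTop (OrdLattice a ha)) ≤ ν (z * t) := by
      rw [le_map_iff_nonneg_map_div ht, mul_div_cancel_right₀ _ ht0]
      exact hz'
    obtain ⟨x, hx⟩ := happrox _ hzt
    have hxu : x ∈ valueIdeal h u := by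
      rw [mem_valueIdeal, ← sub_sub_cancel (z * t) (algebraMap R F x)]
      exact AddValuation.map_le_sub ν hzt hx.le
    refine ⟨⟨x, hxu⟩, ?_⟩
    rw [hf _ (hmem _), eq_comm, ← sub_eq_zero, ← map_sub, residue_eq_zero_iff_pos]
    rw [lt_map_iff_pos_map_div ht] at hx
    convert hx using 2
    change z - algebraMap R F x / t = _
    field_simp
  · intro x hx
    rw [hf x (hmem x), residue_eq_zero_iff_pos]
    exact (lt_map_iff_pos_map_div ht).1 hx
  · rintro x ⟨hxI, hxu⟩
    exact lt_of_le_of_ne hxu fun he => hI ⟨x, hxI, he.symm⟩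

theorem valueIdeal_eq_top (h : IsDominatedBy R ν) {t : OrdLattice a ha}
    (ht : ∀ u ∈ valueSemigroup R ν, t ≤ u) : valueIdeal h t = ⊤ := by
  refine (Ideal.eq_top_iff_one _).2 ?_
  rw [mem_valueIdeal, map_one, AddValuation.map_one]
  have : t ≤ 0 := ht 0 ⟨1, Submodule.mem_top, by rw [map_one, AddValuation.map_one]; rfl⟩
  exact_mod_cast this

theorem valueIdeal_eq_valueIdealLT (h : IsDominatedBy R ν) {t u : OrdLattice a ha} (hut : u < t)
    (hmax : ∀ v ∈ valueSemigroup R ν, v < t → v ≤ u) : valueIdeal h t = valueIdealLT h u := by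
  ext r
  rw [mem_valueIdeal, mem_valueIdealLT]
  by_cases hr : algebraMap R F r = 0
  · simp [hr]
  · obtain ⟨v, hv⟩ := exists_map_eq_coe (ν := ν) hr
    rw [hv, WithTop.coe_le_coe, WithTop.coe_lt_coe]
    refine ⟨fun h => hut.trans_le h, fun h => ?_⟩
    by_contra hlt
    exact absurd (hmax v ⟨r, Submodule.mem_top, hv⟩ (not_le.1 hlt)) (not_le.2 h)

/-- Only values u with u - w ∉ ν(I) can contribute. At the others every element of value at least u
is approximated from I, and the jump vanishes. -/
theorem length_quotient_sup_valueIdeal_le (h : IsDominatedBy R ν)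
    (hext : (residueExtension h).Finite)
    (hsurj : ∀ u : OrdLattice a ha, ∃ x : F, ν x = (u : WithTop (OrdLattice a ha)))
    (hfin : ∀ t : OrdLattice a ha, {u ∈ valueSemigroup R ν | u < t}.Finite)
    {w : OrdLattice a ha} {I : Ideal R}
    (hw : ∀ u ∈ valueSet ν I, ∀ y : F,
      ((u + w : OrdLattice a ha) : WithTop (OrdLattice a ha)) ≤ ν y →
        ∃ x ∈ I, ((u + w : OrdLattice a ha) : WithTop (OrdLattice a ha)) <
          ν (y - algebraMap R F x)) (t : OrdLattice a ha) :
    Module.length R (R ⧸ (I ⊔ valueIdeal h t)) ≤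
      residueDegree h *
        {u | u ∈ valueSemigroup R ν ∧ u < t ∧ u - w ∉ valueSet ν I}.encard := by
  induction t using threshold_induction hfin with
  | base t ht =>
    rw [valueIdeal_eq_top h ht, sup_top_eq, Module.length_eq_zero]
    exact zero_le
  | step t u hu hut hmax ih =>
    have hsub : {v | v ∈ valueSemigroup R ν ∧ v < u ∧ v - w ∉ valueSet ν I} ⊆
        {v | v ∈ valueSemigroup R ν ∧ v < t ∧ v - w ∉ valueSet ν I} :=
      fun v hv => ⟨hv.1, hv.2.1.trans hut, hv.2.2⟩
    rw [valueIdeal_eq_valueIdealLT h hut hmax]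
    by_cases huI : u - w ∈ valueSet ν I
    · have hle : I ⊔ valueIdeal h u ≤ I ⊔ valueIdealLT h u := by
        refine sup_le le_sup_left fun y hy => ?_
        obtain ⟨x, hx, hxy⟩ := hw _ huI (algebraMap R F y) (by rwa [sub_add_cancel])
        rw [sub_add_cancel, ← map_sub] at hxy
        rw [← add_sub_cancel x y]
        exact Ideal.add_mem _ (Ideal.mem_sup_left hx) (Ideal.mem_sup_right hxy)
      exact (length_quotient_mono hle).trans (ih.trans (by gcongr))
    · refine (length_quotient_sup_valueIdealLT_le h hext hsurj I u).trans ?_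
      have hins : insert u {v | v ∈ valueSemigroup R ν ∧ v < u ∧ v - w ∉ valueSet ν I} ⊆
          {v | v ∈ valueSemigroup R ν ∧ v < t ∧ v - w ∉ valueSet ν I} :=
        Set.insert_subset ⟨hu, hut, huI⟩ hsub
      refine le_trans ?_ (mul_le_mul_right (Set.encard_le_encard hins) _)
      rw [Set.encard_insert_of_notMem fun h => lt_irrefl _ h.2.1, mul_add, mul_one]
      gcongr

/-- At the values counted here the jump is full, because u - w ∈ S gives all leading forms; jumps at
other values are discarded. -/
theorem le_length_quotient_sup_valueIdeal (h : IsDominatedBy R ν)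
    (hext : (residueExtension h).Finite)
    (hsurj : ∀ u : OrdLattice a ha, ∃ x : F, ν x = (u : WithTop (OrdLattice a ha)))
    (hfin : ∀ t : OrdLattice a ha, {u ∈ valueSemigroup R ν | u < t}.Finite)
    {w : OrdLattice a ha} (hwS : w ∈ valueSemigroup R ν) (I : Ideal R)
    (hw : ∀ u ∈ valueSemigroup R ν, ∀ y : F,
      ((u + w : OrdLattice a ha) : WithTop (OrdLattice a ha)) ≤ ν y →
        ∃ x : R, ((u + w : OrdLattice a ha) : WithTop (OrdLattice a ha)) <
          ν (y - algebraMap R F x)) (t : OrdLattice a ha) :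
    residueDegree h *
        {u | u - w ∈ valueSemigroup R ν ∧ u < t ∧ u ∉ valueSet ν I}.encard ≤
      Module.length R (R ⧸ (I ⊔ valueIdeal h t)) := by
  have hS : ∀ v, v - w ∈ valueSemigroup R ν → v ∈ valueSemigroup R ν := fun v hv =>
    sub_add_cancel v w ▸ valueSemigroup_add_valueSet hv hwS
  induction t using threshold_induction hfin with
  | base t ht =>
    have : {u | u - w ∈ valueSemigroup R ν ∧ u < t ∧ u ∉ valueSet ν I} = ∅ :=
      Set.eq_empty_of_forall_notMem fun u hu => absurd hu.2.1 (not_lt.2 (ht u (hS u hu.1)))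
    rw [this]
    simp
  | step t u hu hut hmax ih =>
    rw [valueIdeal_eq_valueIdealLT h hut hmax]
    have hsub : {v | v - w ∈ valueSemigroup R ν ∧ v < t ∧ v ∉ valueSet ν I} ⊆
        insert u {v | v - w ∈ valueSemigroup R ν ∧ v < u ∧ v ∉ valueSet ν I} := by
      rintro v ⟨hv, hvt, hvI⟩
      rcases (hmax v (hS v hv) hvt).eq_or_lt with rfl | hlt
      · exact Set.mem_insert _ _
      · exact Set.mem_insert_of_mem _ ⟨hv, hlt, hvI⟩
    by_cases huB : u - w ∈ valueSemigroup R ν ∧ u ∉ valueSet ν I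
    · refine (mul_le_mul_right (Set.encard_le_encard hsub) _).trans ?_
      rw [Set.encard_insert_of_notMem fun h => lt_irrefl _ h.2.1, mul_add, mul_one]
      refine (add_le_add_left ih _).trans
        (le_length_quotient_sup_valueIdealLT h hext hsurj (fun y hy => ?_) huB.2)
      simpa using hw _ huB.1 y (by simpa using hy)
    · have hsub' : {v | v - w ∈ valueSemigroup R ν ∧ v < t ∧ v ∉ valueSet ν I} ⊆
          {v | v - w ∈ valueSemigroup R ν ∧ v < u ∧ v ∉ valueSet ν I} := by
        intro v hv
        rcases hsub hv with rfl | hv'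
        · exact absurd ⟨hv.1, hv.2.2⟩ huB
        · exact hv'
      refine (mul_le_mul_right (Set.encard_le_encard hsub') _).trans (ih.trans ?_)
      exact length_quotient_mono (sup_le_sup_left (valueIdealLT_le h u) I)

end ValueFiltration

/-! ### Asymptotic colengths -/

section Asymptotics

variable {d : ℕ} {a : EuclideanSpace ℝ (Fin d)} {ha : LinearIndependent ℚ (fun i => a i)}
variable {R : Type*} [CommRing R] {F : Type*} [Field F] [Algebra R F]
variable {ν : AddValuation F (WithTop (OrdLattice a ha))}

variable (R ν) in
/-- The value semigroup, as a submonoid of `ℤ^d`. -/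
def valueSubmonoid : AddSubmonoid (Fin d → ℤ) where
  carrier := valueSemigroup R ν
  add_mem' hu hv := valueSemigroup_add_valueSet (ν := ν) hu hv
  zero_mem' := ⟨1, Submodule.mem_top, by rw [map_one, AddValuation.map_one]; rfl⟩

/-- The value set of an ideal, as a subset of `ℤ^d`. -/
def latticeValueSet (ν : AddValuation F (WithTop (OrdLattice a ha))) (I : Ideal R) :
    Set (Fin d → ℤ) :=
  valueSet ν I

theorem latticeValueSet_subset (I : Ideal R) {u : Fin d → ℤ} (hu : u ∈ latticeValueSet ν I) :
    u ∈ valueSubmonoid R ν := by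
  obtain ⟨x, -, hx⟩ := hu
  exact ⟨x, Submodule.mem_top, hx⟩

theorem latticeValueSet_add_mem (I : Ideal R) {u s : Fin d → ℤ} (hu : u ∈ latticeValueSet ν I)
    (hs : s ∈ valueSubmonoid R ν) : u + s ∈ latticeValueSet ν I :=
  valueSemigroup_add_valueSet (ν := ν) hu hs

variable (R ν) in
/-- The limit of the rescaled complements of the value sets of a family of ideals. -/
def limitComplement (N : ℕ → ℕ) (I : ℕ → Ideal R) : Set (EuclideanSpace ℝ (Fin d)) :=
  openCone (valueSubmonoid R ν) \
    closure (limitRegion (valueSubmonoid R ν) N fun k => latticeValueSet ν (I k))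

variable (ν) in
/-- The upper Kuratowski limit of the rescaled value sets of a family lies in the lower one. -/
def HasValueLimit (N : ℕ → ℕ) (I : ℕ → Ideal R) : Prop :=
  upperLimit N (fun k => latticeValueSet ν (I k)) ⊆ lowerLimit N fun k => latticeValueSet ν (I k)

theorem toReal_nsmul (n : ℕ) (v : OrdLattice a ha) : (n • v).toReal = n * v.toReal := by
  induction n with
  | zero =>
    rw [zero_nsmul, OrdLattice.toReal_eq]
    simp only [Nat.cast_zero, zero_mul]
    refine Finset.sum_eq_zero fun i _ => ?_
    rw [mul_eq_zero]
    exact Or.inl (by exact_mod_cast rfl)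
  | succ n ih =>
    rw [succ_nsmul, OrdLattice.toReal_add, ih]
    push_cast
    ring

theorem measurableSet_limitComplement {N : ℕ → ℕ} {I : ℕ → Ideal R} :
    MeasurableSet (limitComplement R ν N I) :=
  isOpen_interior.measurableSet.diff isClosed_closure.measurableSet

theorem mem_complRegion_iff {J : Ideal R} {n : ℕ} (hn : 0 < n)
    (x : EuclideanSpace ℝ (Fin d)) :
    x ∈ complRegion ν J n ↔
      floorVec n x ∈ {u | u ∈ valueSubmonoid R ν ∧ u ∉ latticeValueSet ν J} :=
  mem_cubeUnion_iff hn x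

variable [IsLocalRing R]

theorem IsOKValuation.closure_valueSubmonoid (hν : IsOKValuation R ν) :
    AddSubgroup.closure (valueSubmonoid R ν : Set (Fin d → ℤ)) = ⊤ :=
  hν.closure_eq_top

theorem IsOKValuation.exists_norm_le (hν : IsOKValuation R ν) :
    ∃ c : ℝ, 0 < c ∧ ∀ u ∈ valueSemigroup R ν, c * ‖latticePoint u‖ ≤ u.toReal := by
  obtain ⟨c, hc, -, h⟩ := hν.pointed
  exact ⟨c, hc, fun u hu => h _ (subset_closedCone _ ⟨u, hu, rfl⟩)⟩

theorem IsOKValuation.finite_lt (hν : IsOKValuation R ν) (t : OrdLattice a ha) :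
    {u ∈ valueSemigroup R ν | u < t}.Finite := by
  obtain ⟨c, hc, h⟩ := hν.exists_norm_le
  refine (finite_norm_latticePoint_le (d := d) (t.toReal / c)).subset fun u hu => ?_
  rw [Set.mem_ofPred_eq, le_div_iff₀' hc]
  exact (h u hu.1).trans ((OrdLattice.le_iff u t).1 hu.2.le)

/-- The threshold is (m N_k) v, with v from the OK bound and m the BBL constant. Pointedness turns
its linear growth into a linear bound on norms. -/
theorem IsOKValuation.exists_valueIdeal_le (hν : IsOKValuation R ν) {N : ℕ → ℕ}
    {I : ℕ → Ideal R} (hI : IsBBL N I) :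
    ∃ β : ℕ → OrdLattice a ha, ∃ B : ℝ, (∀ k, valueIdeal hν.dominated (β k) ≤ I k) ∧
      ∀ k, ∀ u ∈ valueSemigroup R ν, u < β k → ‖latticePoint u‖ ≤ B * N k := by
  obtain ⟨c, hc, h⟩ := hν.exists_norm_le
  obtain ⟨v, hv⟩ := hν.exists_bound
  obtain ⟨m, hm⟩ := hI
  refine ⟨fun k => (m * N k) • v, m * v.toReal / c, fun k r hr => hm k (hv _ _ hr),
    fun k u hu hlt => ?_⟩
  have h1 := (OrdLattice.le_iff _ _).1 hlt.le
  rw [toReal_nsmul] at h1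
  push_cast at h1
  rw [div_mul_eq_mul_div, le_div_iff₀' hc]
  refine (h u hu).trans (h1.trans (le_of_eq ?_))
  ring

theorem lt_of_not_mem_valueSet (h : IsDominatedBy R ν) {I : Ideal R} {t u : OrdLattice a ha}
    (ht : valueIdeal h t ≤ I) (hu : u ∈ valueSemigroup R ν) (huI : u ∉ valueSet ν I) : u < t := by
  obtain ⟨x, -, hx⟩ := hu
  by_contra hlt
  refine huI ⟨x, ht ?_, hx⟩
  rw [mem_valueIdeal, hx]
  exact WithTop.coe_le_coe.2 (not_lt.1 hlt)

section Limits

variable {N : ℕ → ℕ} {I : ℕ → Ideal R}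

theorem IsOKValuation.ae_eventually_mem_iff (hν : IsOKValuation R ν)
    (hN : Tendsto N atTop atTop) (hlim : HasValueLimit ν N I) (w w' : Fin d → ℤ) :
    ∀ᵐ x, ∀ᶠ n in atTop, floorVec (N n) x ∈
      {u | u - w ∈ valueSubmonoid R ν ∧ u - w' ∉ latticeValueSet ν (I n)} ↔
        x ∈ limitComplement R ν N I :=
  ae_eventually_floorVec_mem_iff hν.closure_valueSubmonoid hN
    (fun n _ hu _ hs => latticeValueSet_add_mem (I n) hu hs) hlim w w'

theorem IsOKValuation.ae_eventually_valueCompl_iff (hν : IsOKValuation R ν)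
    (hN : Tendsto N atTop atTop) (hlim : HasValueLimit ν N I) :
    ∀ᵐ x, ∀ᶠ n in atTop, floorVec (N n) x ∈
      {u | u ∈ valueSubmonoid R ν ∧ u ∉ latticeValueSet ν (I n)} ↔
        x ∈ limitComplement R ν N I := by
  simpa only [sub_zero] using hν.ae_eventually_mem_iff hN hlim 0 0

theorem IsOKValuation.volume_limitComplement_lt_top (hν : IsOKValuation R ν)
    (hN : Tendsto N atTop atTop) (hI : IsBBL N I) (hlim : HasValueLimit ν N I) :
    volume (limitComplement R ν N I) < ⊤ := by
  obtain ⟨β, B, hβ, hB⟩ := hν.exists_valueIdeal_le hI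
  exact volume_lt_top_of_ae_eventually hN
    (fun n u hu => hB n u hu.1 (lt_of_not_mem_valueSet hν.dominated (hβ n) hu.1 hu.2))
    (hν.ae_eventually_valueCompl_iff hN hlim)

/-- At almost every point membership in the regions is eventually constant, so infinitely often and
eventually mean the same. -/
theorem IsOKValuation.volume_nablaUp_eq (hν : IsOKValuation R ν)
    (hN : Tendsto N atTop atTop) (hlim : HasValueLimit ν N I) :
    volume (nablaUp ν N I) = volume (limitComplement R ν N I) := by
  refine measure_congr ?_
  filter_upwards [hν.ae_eventually_valueCompl_iff hN hlim] with x hx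
  refine propext ⟨fun h => ?_, fun h => ⟨h.1, Eventually.frequently ?_⟩⟩
  · obtain ⟨n, hn, hn', hn0⟩ := (h.2.and_eventually (hx.and (hN.eventually_gt_atTop 0))).exists
    exact hn'.1 ((mem_complRegion_iff hn0 x).1 hn)
  · filter_upwards [hx, hN.eventually_gt_atTop 0] with n hn hn0
    exact (mem_complRegion_iff hn0 x).2 (hn.2 h)

theorem IsOKValuation.volume_nablaLow_eq (hν : IsOKValuation R ν)
    (hN : Tendsto N atTop atTop) (hlim : HasValueLimit ν N I) :
    volume (nablaLow ν N I) = volume (limitComplement R ν N I) := by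
  refine measure_congr ?_
  filter_upwards [hν.ae_eventually_valueCompl_iff hN hlim] with x hx
  refine propext ⟨fun h => ?_, fun h => ⟨h.1, ?_⟩⟩
  · obtain ⟨n, hn, hn', hn0⟩ := (h.2.and (hx.and (hN.eventually_gt_atTop 0))).exists
    exact hn'.1 ((mem_complRegion_iff hn0 x).1 hn)
  · filter_upwards [hx, hN.eventually_gt_atTop 0] with n hn hn0
    exact (mem_complRegion_iff hn0 x).2 (hn.2 h)

variable [IsFractionRing R F]

/-- The normalized colengths of a family of ideals whose rescaled value sets converge. -/
theorem IsOKValuation.tendsto_normalizedColength (hν : IsOKValuation R ν)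
    (hN : Tendsto N atTop atTop) (hI : IsBBL N I) (hlim : HasValueLimit ν N I) :
    Tendsto (fun n => normalizedColength d (I n) (N n)) atTop
      (𝓝 (residueDegree hν.dominated * volume (limitComplement R ν N I))) := by
  obtain ⟨β, B, hβ, hB⟩ := hν.exists_valueIdeal_le hI
  obtain ⟨w, hwS, hw⟩ := exists_shift hν.dominated hν.finite_residueExtension
  have hlt : ∀ n u, u ∈ valueSemigroup R ν → u ∉ valueSet ν (I n) → u < β n := fun n u hu huI =>
    lt_of_not_mem_valueSet hν.dominated (hβ n) hu huI
  have hS : ∀ u : OrdLattice a ha, u - w ∈ valueSemigroup R ν → u ∈ valueSemigroup R ν :=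
    fun u hu => sub_add_cancel u w ▸ valueSemigroup_add_valueSet hu hwS
  have hsup : ∀ n, I n ⊔ valueIdeal hν.dominated (β n) = I n := fun n => sup_eq_left.2 (hβ n)
  -- The bound u < β n keeps the set finite and is harmless in the limit: at almost every point of
  -- the limit set the cell is eventually in S \ ν(I n), hence below β n.
  have hupper := tendsto_encard_div_pow hN (B := B)
    (A := fun n => {u : OrdLattice a ha | u ∈ valueSemigroup R ν ∧ u < β n ∧
      u - w ∉ valueSet ν (I n)})
    (fun n u hu => hB n u hu.1 hu.2.1) measurableSet_limitComplement (by
      filter_upwards [hν.ae_eventually_valueCompl_iff hN hlim,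
        hν.ae_eventually_mem_iff hN hlim 0 w] with x hx hx'
      filter_upwards [hx, hx'] with n hn hn'
      refine ⟨fun h => hn'.1 ⟨?_, h.2.2⟩, fun h => ⟨(hn.2 h).1, hlt n _ (hn.2 h).1 (hn.2 h).2,
        (hn'.2 h).2⟩⟩
      rw [sub_zero]
      exact h.1)
  have hlower := tendsto_encard_div_pow hN (B := B)
    (A := fun n => {u : OrdLattice a ha | u - w ∈ valueSemigroup R ν ∧ u < β n ∧
      u ∉ valueSet ν (I n)})
    (fun n u hu => hB n u (hS u hu.1) hu.2.1) measurableSet_limitComplement (by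
      filter_upwards [hν.ae_eventually_mem_iff hN hlim w 0] with x hx
      filter_upwards [hx] with n hn
      rw [← hn]
      refine ⟨fun h => ⟨h.1, ?_⟩, fun h => ⟨h.1, hlt n _ (hS _ h.1) ?_, ?_⟩⟩
      · rw [sub_zero]
        exact h.2.2
      · exact sub_zero (floorVec (N n) x) ▸ h.2
      · exact sub_zero (floorVec (N n) x) ▸ h.2)
  have hD : ((residueDegree hν.dominated : ℝ≥0∞)) ≠ ⊤ := ENNReal.natCast_ne_top _
  -- Both counts have the same limit, since the fixed shift w is invisible after rescaling.
  refine tendsto_of_tendsto_of_tendsto_of_le_of_le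
    (ENNReal.Tendsto.const_mul hlower (Or.inr hD)) (ENNReal.Tendsto.const_mul hupper (Or.inr hD))
    (fun n => ?_) fun n => ?_
  · have := le_length_quotient_sup_valueIdeal hν.dominated hν.finite_residueExtension
      hν.surjective hν.finite_lt hwS (I n)
      (fun u hu y hy => (hw ⊤ u hu y hy).imp fun _ h => h.2) (β n)
    rw [hsup, ← ENat.toENNReal_le, ENat.toENNReal_mul, ENat.toENNReal_coe] at this
    simp only [normalizedColength, ← mul_div_assoc]
    exact ENNReal.div_le_div_right this _
  · have := length_quotient_sup_valueIdeal_le hν.dominated hν.finite_residueExtension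
      hν.surjective hν.finite_lt (hw (I n)) (β n)
    rw [hsup, ← ENat.toENNReal_le, ENat.toENNReal_mul, ENat.toENNReal_coe] at this
    simp only [normalizedColength, ← mul_div_assoc]
    exact ENNReal.div_le_div_right this _

end Limits

end Asymptotics

/-! ### Weakly graded families and weakly `p`-families -/

section Families

variable {d : ℕ} {a : EuclideanSpace ℝ (Fin d)} {ha : LinearIndependent ℚ (fun i => a i)}
variable {R : Type*} [CommRing R] {F : Type*} [Field F] [Algebra R F]
variable {ν : AddValuation F (WithTop (OrdLattice a ha))}

/-- In a domain the zero ideal is itself a prime with quotient of full dimension. -/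
theorem ne_zero_of_mem_topDimCompl [IsDomain R] {c : R} (hc : c ∈ topDimCompl R) : c ≠ 0 := by
  intro h
  refine hc ⊥ Ideal.isPrime_bot (ringKrullDim_eq_of_ringEquiv (RingEquiv.quotientBot R)) ?_
  rw [h]
  exact zero_mem _

/-- The element `x` has the value `u ∈ ℤ^d`. -/
def HasValue (ν : AddValuation F (WithTop (OrdLattice a ha))) (x : F) (u : Fin d → ℤ) : Prop :=
  ν x = WithTop.some (α := OrdLattice a ha) u

theorem HasValue.mul {x y : F} {u v : Fin d → ℤ} (hx : HasValue ν x u) (hy : HasValue ν y v) :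
    HasValue ν (x * y) (u + v) := by
  unfold HasValue at *
  rw [AddValuation.map_mul, hx, hy]
  rfl

theorem HasValue.pow {x : F} {u : Fin d → ℤ} (hx : HasValue ν x u) (n : ℕ) :
    HasValue ν (x ^ n) (n • u) := by
  unfold HasValue at *
  rw [AddValuation.map_pow, hx]
  rfl

theorem HasValue.ne_zero {x : F} {u : Fin d → ℤ} (hx : HasValue ν x u) : x ≠ 0 :=
  ne_zero_of_map_eq_coe hx

theorem HasValue.unique {x : F} {u v : Fin d → ℤ} (hu : HasValue ν x u) (hv : HasValue ν x v) :
    u = v :=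
  WithTop.coe_injective (hu.symm.trans hv)

theorem exists_hasValue (ν : AddValuation F (WithTop (OrdLattice a ha))) {x : F} (hx : x ≠ 0) :
    ∃ u, HasValue ν x u :=
  exists_map_eq_coe hx

theorem exists_hasValue_algebraMap [IsFractionRing R F]
    (ν : AddValuation F (WithTop (OrdLattice a ha))) {x : R} (hx : x ≠ 0) :
    ∃ u, HasValue ν (algebraMap R F x) u :=
  exists_hasValue ν ((map_ne_zero_iff _ (IsFractionRing.injective R F)).2 hx)

theorem mem_latticeValueSet {I : Ideal R} {u : Fin d → ℤ} :
    u ∈ latticeValueSet ν I ↔ ∃ x ∈ I, HasValue ν (algebraMap R F x) u := Iff.rfl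

theorem latticeValueSet_nonempty [IsFractionRing R F] {I : Ideal R} (hI : I ≠ ⊥) :
    (latticeValueSet ν I).Nonempty := by
  obtain ⟨x, hx, hx0⟩ := Submodule.exists_mem_ne_zero_of_ne_bot hI
  obtain ⟨u, hu⟩ := exists_hasValue_algebraMap ν hx0
  exact ⟨u, x, hx, hu⟩

theorem add_add_mem_latticeValueSet {I J L : Ideal R} {c : R} {u v w : Fin d → ℤ}
    (h : Ideal.span {c} * (I * J) ≤ L) (hw : HasValue ν (algebraMap R F c) w)
    (hu : u ∈ latticeValueSet ν I) (hv : v ∈ latticeValueSet ν J) :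
    w + (u + v) ∈ latticeValueSet ν L := by
  obtain ⟨x, hx, hxu⟩ := mem_latticeValueSet.1 hu
  obtain ⟨y, hy, hyv⟩ := mem_latticeValueSet.1 hv
  refine ⟨c * (x * y),
    h (Ideal.mul_mem_mul (Ideal.mem_span_singleton_self c) (Ideal.mul_mem_mul hx hy)), ?_⟩
  rw [RingHom.map_mul, RingHom.map_mul]
  exact hw.mul (hxu.mul hyv)

theorem nsmul_add_mem_latticeValueSet {I L : Ideal R} {c : R} {p : ℕ} {u w : Fin d → ℤ}
    (h : Ideal.span {c} * frobeniusPower p I ≤ L) (hw : HasValue ν (algebraMap R F c) w)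
    (hu : u ∈ latticeValueSet ν I) : w + p • u ∈ latticeValueSet ν L := by
  obtain ⟨x, hx, hxu⟩ := mem_latticeValueSet.1 hu
  refine ⟨c * x ^ p, h (Ideal.mul_mem_mul (Ideal.mem_span_singleton_self c)
    (Ideal.subset_span ⟨x, hx, rfl⟩)), ?_⟩
  rw [RingHom.map_mul, RingHom.map_pow]
  exact hw.mul (hxu.pow p)

theorem tendsto_pow_atTop_nat {p : ℕ} (hp : 1 < p) :
    Tendsto (fun e : ℕ => p ^ e) atTop atTop :=
  tendsto_pow_atTop_atTop_of_one_lt hp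

theorem hasValueLimit_of_isWeaklyP [IsDomain R] [IsFractionRing R F] {p : ℕ} (hp : 1 < p)
    {I : ℕ → Ideal R} (h : IsWeaklyP p I) : HasValueLimit ν (fun e => p ^ e) I := by
  obtain ⟨c, hc, hcI⟩ := h
  obtain ⟨w, hw⟩ := exists_hasValue_algebraMap ν (ne_zero_of_mem_topDimCompl hc)
  have hp2 : (2 : ℝ) ≤ p := by exact_mod_cast hp
  have hp0 : (0 : ℝ) < p := by linarith
  refine upperLimit_subset_lowerLimit_of_forward (tendsto_pow_atTop_nat hp)
    ‖latticePoint w‖ fun m _ u hu δ hδ => ?_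
  -- The extra ‖w‖ on the left closes the induction: one step multiplies the error by p and adds
  -- ‖w‖, and 2‖w‖ ≤ p‖w‖.
  have key : ∀ j : ℕ, ∃ k ∈ latticeValueSet ν (I (m + j)),
      ‖latticePoint k - (p : ℝ) ^ j • latticePoint u‖ + ‖latticePoint w‖ ≤
        ‖latticePoint w‖ * p ^ j := by
    intro j
    induction j with
    | zero => exact ⟨u, hu, by simp⟩
    | succ j ih =>
      obtain ⟨k, hk, hku⟩ := ih
      refine ⟨w + p • k, nsmul_add_mem_latticeValueSet (hcI (m + j)) hw hk, ?_⟩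
      have e : latticePoint (w + p • k) - (p : ℝ) ^ (j + 1) • latticePoint u =
          latticePoint w + (p : ℝ) • (latticePoint k - (p : ℝ) ^ j • latticePoint u) := by
        rw [latticePoint_add, latticePoint_nsmul, pow_succ', mul_smul]
        module
      have h1 := norm_add_le (latticePoint w)
        ((p : ℝ) • (latticePoint k - (p : ℝ) ^ j • latticePoint u))
      rw [norm_smul, Real.norm_natCast] at h1
      rw [e, pow_succ]
      nlinarith [norm_nonneg (latticePoint w), mul_le_mul_of_nonneg_left hku hp0.le]
  filter_upwards [eventually_ge_atTop m] with n hn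
  obtain ⟨j, rfl⟩ := Nat.exists_eq_add_of_le hn
  obtain ⟨k, hk, hku⟩ := key j
  refine ⟨k, hk, ?_⟩
  have hpm : (0 : ℝ) < (p : ℝ) ^ m := by positivity
  have e1 : ((p ^ (m + j) : ℕ) : ℝ) / ((p ^ m : ℕ) : ℝ) = (p : ℝ) ^ j := by
    push_cast
    rw [pow_add, mul_div_cancel_left₀ _ hpm.ne']
  have e2 : ‖latticePoint w‖ / ((p ^ m : ℕ) : ℝ) * ((p ^ (m + j) : ℕ) : ℝ) =
      ‖latticePoint w‖ * (p : ℝ) ^ j := by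
    rw [← e1]; ring
  rw [e1, add_mul, e2]
  have : 0 ≤ δ * ((p ^ (m + j) : ℕ) : ℝ) := by positivity
  linarith [norm_nonneg (latticePoint w)]

/-- Iterated division by p keeps the error bounded, since the errors of the successive steps form a
geometric series. -/
theorem hasValueLimit_of_exists_nsmul_near {p : ℕ} (hp : 1 < p) {I : ℕ → Ideal R} {M : ℝ}
    (h : ∀ e, ∀ u ∈ latticeValueSet ν (I (e + 1)), ∃ k ∈ latticeValueSet ν (I e),
      ‖(p : ℝ) • latticePoint k - latticePoint u‖ ≤ M) :
    HasValueLimit ν (fun e => p ^ e) I := by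
  have hp2 : (2 : ℝ) ≤ p := by exact_mod_cast hp
  have hp0 : (0 : ℝ) < p := by linarith
  -- The scaled new error and the old one are each at most |M| p^j, and 2 ≤ p lets their sum fit in
  -- |M| p^(j+1).
  have key : ∀ j e : ℕ, ∀ u ∈ latticeValueSet ν (I (e + j)), ∃ k ∈ latticeValueSet ν (I e),
      ‖(p : ℝ) ^ j • latticePoint k - latticePoint u‖ ≤ |M| * p ^ j := by
    intro j
    induction j with
    | zero => exact fun e u hu => ⟨u, hu, by simp⟩
    | succ j ih =>
      intro e u hu
      obtain ⟨k', hk', hku'⟩ := ih (e + 1) u (by rwa [add_right_comm, add_assoc])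
      obtain ⟨k, hk, hku⟩ := h e k' hk'
      refine ⟨k, hk, ?_⟩
      have e1 : (p : ℝ) ^ (j + 1) • latticePoint k - latticePoint u =
          (p : ℝ) ^ j • ((p : ℝ) • latticePoint k - latticePoint k') +
            ((p : ℝ) ^ j • latticePoint k' - latticePoint u) := by
        rw [pow_succ, mul_smul]
        module
      rw [e1]
      refine (norm_add_le _ _).trans ?_
      rw [norm_smul, norm_pow, Real.norm_natCast, pow_succ]
      have h1 : (p : ℝ) ^ j * ‖(p : ℝ) • latticePoint k - latticePoint k'‖ ≤ p ^ j * |M| := by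
        gcongr
        exact hku.trans (le_abs_self M)
      have h2 : 0 ≤ |M| * (p : ℝ) ^ j := by positivity
      nlinarith
  refine upperLimit_subset_lowerLimit_of_backward (tendsto_pow_atTop_nat hp) |M|
    fun n m hnm _ u hu => ?_
  obtain ⟨j, rfl⟩ := Nat.exists_eq_add_of_le hnm
  obtain ⟨k, hk, hku⟩ := key j n u hu
  refine ⟨k, hk, ?_⟩
  have hpj : (0 : ℝ) < (p : ℝ) ^ j := by positivity
  have hpn : (0 : ℝ) < (p : ℝ) ^ n := by positivity
  have e1 : latticePoint k - (((p ^ n : ℕ) : ℝ) / ((p ^ (n + j) : ℕ) : ℝ)) • latticePoint u =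
      ((p : ℝ) ^ j)⁻¹ • ((p : ℝ) ^ j • latticePoint k - latticePoint u) := by
    rw [smul_sub, smul_smul, inv_mul_cancel₀ hpj.ne', one_smul]
    congr 2
    push_cast
    rw [pow_add]
    field_simp
  rw [e1, norm_smul, Real.norm_of_nonneg (by positivity), inv_mul_le_iff₀ hpj]
  linarith

variable [IsLocalRing R]

theorem IsOKValuation.dim_pos (hν : IsOKValuation R ν) : 0 < d := by
  obtain ⟨c, hc, hca, -⟩ := hν.pointed
  rcases Nat.eq_zero_or_pos d with rfl | h
  · have : a = 0 := Subsingleton.elim _ _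
    rw [this, norm_zero] at hca
    exact absurd hca (not_lt.2 hc.le)
  · exact h

theorem IsOKValuation.maximalIdeal_ne_bot [IsDomain R] (hν : IsOKValuation R ν) :
    IsLocalRing.maximalIdeal R ≠ ⊥ := by
  intro h
  have h1 := ringKrullDim_eq_zero_of_isField (IsLocalRing.isField_iff_maximalIdeal_eq.2 h)
  rw [hν.dim_eq] at h1
  exact hν.dim_pos.ne' (by exact_mod_cast h1)

theorem IsOKValuation.ne_bot_of_isBBL [IsDomain R] (hν : IsOKValuation R ν) {N : ℕ → ℕ}
    {I : ℕ → Ideal R} (hI : IsBBL N I) (n : ℕ) : I n ≠ ⊥ := by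
  obtain ⟨c, hc⟩ := hI
  exact fun h => pow_ne_zero _ hν.maximalIdeal_ne_bot (le_bot_iff.1 (h ▸ hc n))

/-- Write n = mq + r with r < m. From u ∈ ν(I m), take q factors of value u and one of value z r ∈
ν(I r); each of the q multiplications costs w = ν(c), so the relative error is about ‖w‖/m. -/
theorem IsOKValuation.hasValueLimit_of_isWeaklyGraded [IsDomain R] [IsFractionRing R F]
    (hν : IsOKValuation R ν) {I : ℕ → Ideal R} (hI : IsBBL (fun n => n) I)
    (h : IsWeaklyGraded I) : HasValueLimit ν (fun n => n) I := by
  obtain ⟨c, hc, hcI⟩ := h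
  obtain ⟨w, hw⟩ := exists_hasValue_algebraMap ν (ne_zero_of_mem_topDimCompl hc)
  choose z hz using fun r => latticeValueSet_nonempty (ν := ν) (hν.ne_bot_of_isBBL hI r)
  refine upperLimit_subset_lowerLimit_of_forward tendsto_id ‖latticePoint w‖
    fun m hm u hu δ hδ => ?_
  have hm0 : (0 : ℝ) < m := by exact_mod_cast hm
  have key : ∀ r q : ℕ, q • (w + u) + z r ∈ latticeValueSet ν (I (m * q + r)) := by
    intro r q
    induction q with
    | zero => simpa using hz r
    | succ q ih =>
      have h1 := add_add_mem_latticeValueSet (hcI m (m * q + r)) hw hu ih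
      have h2 : m + (m * q + r) = m * (q + 1) + r := by ring
      rw [h2] at h1
      convert h1 using 1
      rw [succ_nsmul]
      abel
  -- Only finitely many remainders r < m occur, so the part of the error not growing with n is
  -- bounded by Z.
  set Z : ℝ := ∑ r ∈ Finset.range m, ‖latticePoint (z r)‖ + ‖latticePoint u‖
  filter_upwards [tendsto_natCast_atTop_atTop.eventually_ge_atTop (Z / δ)] with n hn
  rw [div_le_iff₀' hδ] at hn
  have hmod : n % m < m := Nat.mod_lt n hm
  have hk := key (n % m) (n / m)
  rw [Nat.div_add_mod] at hk
  refine ⟨_, hk, ?_⟩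
  have hn' : (n : ℝ) = m * (n / m : ℕ) + (n % m : ℕ) := by
    exact_mod_cast (Nat.div_add_mod n m).symm
  have hq : ((n / m : ℕ) : ℝ) ≤ n / m := Nat.cast_div_le
  have hr : ((n % m : ℕ) : ℝ) / m ≤ 1 := by
    rw [div_le_one hm0]
    exact_mod_cast hmod.le
  have e : latticePoint ((n / m) • (w + u) + z (n % m)) - ((n : ℝ) / m) • latticePoint u =
      ((n / m : ℕ) : ℝ) • latticePoint w + latticePoint (z (n % m))
        - (((n % m : ℕ) : ℝ) / m) • latticePoint u := by
    have h1 : (n : ℝ) / m = (n / m : ℕ) + ((n % m : ℕ) : ℝ) / m := by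
      rw [hn']
      field_simp
    rw [h1, latticePoint_add, latticePoint_nsmul, latticePoint_add]
    module
  have h3 : ‖latticePoint (z (n % m))‖ ≤ ∑ r ∈ Finset.range m, ‖latticePoint (z r)‖ :=
    Finset.single_le_sum (f := fun r => ‖latticePoint (z r)‖) (fun _ _ => norm_nonneg _)
      (Finset.mem_range.2 hmod)
  have h4 : ‖(((n % m : ℕ) : ℝ) / m) • latticePoint u‖ ≤ ‖latticePoint u‖ := by
    rw [norm_smul, Real.norm_of_nonneg (by positivity)]
    exact mul_le_of_le_one_left (norm_nonneg _) hr
  have h5 : ‖((n / m : ℕ) : ℝ) • latticePoint w‖ ≤ ‖latticePoint w‖ / m * n := by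
    rw [norm_smul, Real.norm_natCast, div_mul_eq_mul_div, mul_div_assoc, mul_comm]
    gcongr
  rw [e]
  refine (norm_sub_le _ _).trans ((add_le_add_left (norm_add_le _ _) _).trans ?_)
  rw [add_mul]
  linarith

end Families

/-! ### Modules with scalars twisted by a ring endomorphism -/

section Twist

variable {A : Type*} [CommRing A] (f : A →+* A)

/-- A module with scalars acting through the ring endomorphism `f`. -/
def Twist (_f : A →+* A) (M : Type*) : Type _ := M

variable {M M' : Type*} [AddCommGroup M] [Module A M] [AddCommGroup M'] [Module A M']

instance : AddCommGroup (Twist f M) := inferInstanceAs (AddCommGroup M)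

instance : Module A (Twist f M) := Module.compHom M f

/-- The identity map to the twisted module. -/
def Twist.of : M ≃+ Twist f M := AddEquiv.refl M

variable {f}

theorem Twist.smul_of (r : A) (x : M) : r • Twist.of f x = Twist.of f (f r • x) := rfl

/-- The functoriality of twisting. -/
def Twist.map (g : M →ₗ[A] M') : Twist f M →ₗ[A] Twist f M' where
  toFun x := g x
  map_add' x y := g.map_add x y
  map_smul' r x := g.map_smul (f r) x

theorem length_twist_eq_add (N : Submodule A M) :
    Module.length A (Twist f M) =
      Module.length A (Twist f N) + Module.length A (Twist f (M ⧸ N)) :=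
  Module.length_eq_add_of_exact (Twist.map N.subtype) (Twist.map N.mkQ)
    N.subtype_injective N.mkQ_surjective (LinearMap.exact_subtype_mkQ N)

/-- On a simple module scalars act through the residue field, and there every t agrees with some f
s. -/
theorem isSimpleModule_twist [IsLocalRing A]
    (hf : ∀ t : A, ∃ s : A, t - f s ∈ IsLocalRing.maximalIdeal A) [IsSimpleModule A M] :
    IsSimpleModule A (Twist f M) := by
  obtain ⟨h1, h2⟩ := isSimpleModule_iff_toSpanSingleton_surjective.1
    (inferInstance : IsSimpleModule A M)
  refine isSimpleModule_iff_toSpanSingleton_surjective.2 ⟨h1, fun x hx y => ?_⟩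
  obtain ⟨t, ht⟩ := h2 (show M from x) hx (show M from y)
  obtain ⟨s, hs⟩ := hf t
  refine ⟨s, ?_⟩
  rw [← IsLocalRing.eq_maximalIdeal (IsSimpleModule.annihilator_isMaximal (R := A) (M := M)),
    Module.mem_annihilator] at hs
  have h3 := hs (show M from x)
  rw [sub_smul, sub_eq_zero] at h3
  exact h3.symm.trans ht

theorem length_twist_le [IsLocalRing A]
    (hf : ∀ t : A, ∃ s : A, t - f s ∈ IsLocalRing.maximalIdeal A) :
    Module.length A (Twist f M) ≤ Module.length A M := by
  by_cases h : Module.length A M = ⊤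
  · rw [h]
    exact le_top
  · rw [← ne_eq, Module.length_ne_top_iff] at h
    induction h with
    | @of_subsingleton M _ _ _ =>
      have : Subsingleton (Twist f M) := inferInstanceAs (Subsingleton M)
      rw [Module.length_eq_zero]
      exact zero_le
    | @of_simple_quotient M _ _ N _ _ ih =>
      have := isSimpleModule_twist hf (M := M ⧸ N)
      rw [length_twist_eq_add N, Module.length_eq_one A (Twist f (M ⧸ N)),
        Module.length_eq_add_of_exact N.subtype N.mkQ N.subtype_injective N.mkQ_surjective
          (LinearMap.exact_subtype_mkQ N), Module.length_eq_one A (M ⧸ N)]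
      gcongr

/-- A comparison of colengths from an almost surjective twisted-linear map to a free module. -/
theorem mul_length_quotient_le {ι : Type*} [Fintype ι] [DecidableEq ι] (ψ : Twist f A →ₗ[A] ι → A) {c : A}
    (hc : ∀ i, ∃ x, ∀ j, ψ x j = if j = i then c else 0) (I : Ideal A) :
    Fintype.card ι * Module.length A (A ⧸ I) ≤
      Module.length A (Twist f (A ⧸ I.map f)) +
        Fintype.card ι * Module.length A (A ⧸ (Ideal.span {c} ⊔ I)) := by
  let q : (ι → A) →ₗ[A] (ι → A ⧸ I) := LinearMap.pi fun i => I.mkQ ∘ₗ LinearMap.proj i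
  have hq : Function.Surjective q := fun y => by
    choose x hx using fun i => I.mkQ_surjective (y i)
    exact ⟨x, funext hx⟩
  have hq0 : ∀ x : ι → A, (∀ i, x i ∈ I) → q x = 0 := fun x hx =>
    funext fun i => (Submodule.Quotient.mk_eq_zero _).2 (hx i)
  let θ : Twist f A →ₗ[A] (ι → A ⧸ I) := q ∘ₗ ψ
  let π : Twist f A →ₗ[A] Twist f (A ⧸ I.map f) := Twist.map (I.map f).mkQ
  have hπ : Function.Surjective π := (I.map f).mkQ_surjective
  have hker : LinearMap.ker π ≤ LinearMap.ker θ := by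
    -- The free factor r carries the span induction through scalar multiples. On generators, twisted
    -- linearity turns f z into the scalar z ∈ I.
    have key : ∀ y ∈ I.map f, ∀ r : A, θ (Twist.of f (r * y)) = 0 := by
      intro y hy
      induction hy using Submodule.span_induction with
      | mem y hy =>
        obtain ⟨z, hz, rfl⟩ := hy
        intro r
        have : Twist.of f (r * f z) = z • Twist.of f r := by
          rw [Twist.smul_of, smul_eq_mul, mul_comm]
        rw [this]
        refine hq0 _ fun i => ?_
        rw [map_smul, Pi.smul_apply, smul_eq_mul]
        exact I.mul_mem_right _ hz
      | zero => exact fun r => by rw [mul_zero, map_zero, map_zero]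
      | add y z _ _ hy hz => exact fun r => by rw [mul_add, map_add, map_add, hy, hz, add_zero]
      | smul s y _ ih => exact fun r => by rw [smul_eq_mul, ← mul_assoc]; exact ih _
    intro x hx
    have hx' := key (show A from x)
      ((Submodule.Quotient.mk_eq_zero _).1 (LinearMap.mem_ker.1 hx)) 1
    rw [one_mul] at hx'
    exact hx'
  have h1 : Module.length A (LinearMap.range θ) ≤ Module.length A (Twist f (A ⧸ I.map f)) :=
    calc Module.length A (LinearMap.range θ)
        = Module.length A (LinearMap.range ((LinearMap.ker π).liftQ θ hker)) := by
          rw [Submodule.range_liftQ]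
      _ ≤ Module.length A (Twist f A ⧸ LinearMap.ker π) :=
          Module.length_le_of_surjective _ (LinearMap.surjective_rangeRestrict _)
      _ = _ := (π.quotKerEquivOfSurjective hπ).length_eq
  let K : Ideal A := Ideal.span {c} ⊔ I
  let ρ : (ι → A) →ₗ[A] ((ι → A ⧸ I) ⧸ LinearMap.range θ) := (LinearMap.range θ).mkQ ∘ₗ q
  have hρ : Function.Surjective ρ := ((LinearMap.range θ).mkQ_surjective).comp hq
  -- The image of ψ contains each c e_i, so the cokernel of θ is a quotient of (A ⧸ (c, I))^ι.
  have hKρ : Submodule.pi Set.univ (fun _ : ι => K) ≤ LinearMap.ker ρ := by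
    intro v hv
    have hv' : ∀ i, ∃ r : A, v i - r * c ∈ I := fun i => by
      obtain ⟨y, hy, z, hz, hyz⟩ := Submodule.mem_sup.1 (hv i (Set.mem_univ i))
      obtain ⟨r, rfl⟩ := Ideal.mem_span_singleton'.1 hy
      exact ⟨r, by rw [← hyz, add_sub_cancel_left]; exact hz⟩
    choose r hr using hv'
    choose x hx using hc
    refine (Submodule.Quotient.mk_eq_zero _).2 ⟨∑ i, r i • x i, ?_⟩
    change q (ψ _) = q v
    rw [eq_comm, ← sub_eq_zero, ← map_sub]
    refine hq0 _ fun j => ?_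
    have : ψ (∑ i, r i • x i) j = r j * c := by
      rw [map_sum, Finset.sum_apply, Finset.sum_eq_single j]
      · rw [map_smul, Pi.smul_apply, hx, if_pos rfl, smul_eq_mul]
      · intro i _ hij
        rw [map_smul, Pi.smul_apply, hx, if_neg hij.symm, smul_zero]
      · exact fun h => absurd (Finset.mem_univ j) h
    rw [Pi.sub_apply, this]
    exact hr j
  have h2 : Module.length A ((ι → A ⧸ I) ⧸ LinearMap.range θ) ≤
      Fintype.card ι * Module.length A (A ⧸ K) :=
    calc Module.length A ((ι → A ⧸ I) ⧸ LinearMap.range θ)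
        ≤ Module.length A ((ι → A) ⧸ Submodule.pi Set.univ (fun _ : ι => K)) :=
          Module.length_le_of_surjective ((Submodule.pi Set.univ fun _ : ι => K).liftQ ρ hKρ) (by
            rw [← LinearMap.range_eq_top, Submodule.range_liftQ, LinearMap.range_eq_top]
            exact hρ)
      _ = Module.length A (ι → A ⧸ K) := (Submodule.quotientPi fun _ : ι => K).length_eq
      _ = _ := by rw [Module.length_pi, ENat.card_eq_coe_fintype_card]
  calc Fintype.card ι * Module.length A (A ⧸ I) = Module.length A (ι → A ⧸ I) := by
        rw [Module.length_pi, ENat.card_eq_coe_fintype_card]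
    _ = Module.length A (LinearMap.range θ) +
          Module.length A ((ι → A ⧸ I) ⧸ LinearMap.range θ) :=
        Module.length_eq_add_of_exact _ _ (LinearMap.range θ).subtype_injective
          (LinearMap.range θ).mkQ_surjective (LinearMap.exact_subtype_mkQ _)
    _ ≤ _ := add_le_add h1 h2

end Twist

/-- The pigeonhole bound for powers of an ideal inside powers of an ideal that contains the
`p`-th powers of its generators. -/
theorem pow_le_pow_of_forall_pow_mem {A : Type*} [CommRing A] {J : Ideal A} {p : ℕ}
    (hp : 0 < p) (s : Finset A) (hs : ∀ y ∈ s, y ^ p ∈ J) (n : ℕ) :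
    Ideal.span (s : Set A) ^ (p * (n + s.card)) ≤ J ^ n := by
  classical
  change Submodule.span A (s : Set A) ^ (p * (n + s.card)) ≤ J ^ n
  rw [Submodule.span_pow, Submodule.span_le]
  intro x hx
  obtain ⟨g, rfl⟩ := Set.mem_pow.1 hx
  rw [List.prod_ofFn, Finset.prod_comp (fun y => y) fun i => (g i : A)]
  set k : A → ℕ := fun b =>
    (Finset.univ.filter fun i : Fin (p * (n + s.card)) => (g i : A) = b).card with hk
  have himg : Finset.univ.image (fun i => (g i : A)) ⊆ s := by
    intro y hy
    obtain ⟨i, -, rfl⟩ := Finset.mem_image.1 hy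
    exact (g i).2
  rw [Finset.prod_subset (f := fun b => b ^ k b) himg fun b _ hb => ?_]
  · have hsum : ∑ b ∈ s, k b = p * (n + s.card) := by
      rw [hk, ← Finset.card_eq_sum_card_fiberwise fun i _ => (g i).2, Finset.card_univ,
        Fintype.card_fin]
    -- Each of the `s.card` exponents loses at most p - 1 on rounding down to a multiple of p, so at
    -- least n full p-th powers remain.
    have hdiv : n ≤ ∑ b ∈ s, k b / p := by
      have h1 : p * (n + s.card) ≤ p * (∑ b ∈ s, k b / p + s.card) := by
        rw [← hsum, mul_add, Finset.mul_sum, ← smul_eq_mul p s.card, smul_eq_mul, mul_comm p s.card,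
          ← smul_eq_mul s.card p, ← Finset.sum_const, ← Finset.sum_add_distrib]
        refine Finset.sum_le_sum fun b _ => ?_
        have := Nat.div_add_mod (k b) p
        have := Nat.mod_lt (k b) hp
        omega
      have := Nat.le_of_mul_le_mul_left h1 hp
      omega
    refine Ideal.pow_le_pow_right hdiv ?_
    rw [← Finset.prod_pow_eq_pow_sum]
    refine Ideal.prod_mem_prod fun b hb => ?_
    rw [← Nat.div_add_mod (k b) p, pow_add, pow_mul]
    refine Ideal.mul_mem_right _ _ ?_
    rw [Nat.div_add_mod]
    exact Ideal.pow_mem_pow (hs b hb) _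
  · have : k b = 0 := by
      rw [hk, Finset.card_eq_zero, Finset.filter_eq_empty_iff]
      exact fun i _ hi => hb (Finset.mem_image.2 ⟨i, Finset.mem_univ i, hi⟩)
    rw [this, pow_zero]

/-! ### The Frobenius endomorphism of an `F`-finite domain -/

section FFinite

variable {R : Type*} [CommRing R] {F : Type*} [Field F] [Algebra R F]
variable {p : ℕ}

theorem IsFFinite.exists_finset [ExpChar R p] (h : IsFFinite R p) :
    ∃ s : Finset R, ∀ x : R, ∃ r : R → R, x = ∑ y ∈ s, r y ^ p * y := by
  have : Module.Finite R (Twist (frobenius R p) R) := h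
  obtain ⟨s, hs⟩ := Module.Finite.fg_top (R := R) (M := Twist (frobenius R p) R)
  refine ⟨s, fun x => ?_⟩
  have hx : Twist.of (frobenius R p) x ∈
      Submodule.span R (s : Set (Twist (frobenius R p) R)) := by
    rw [hs]
    exact Submodule.mem_top
  obtain ⟨r, -, hr⟩ := Submodule.mem_span_finset.1 hx
  exact ⟨r, hr.symm⟩

variable [ExpChar F p]

theorem twist_of_sum_pow_mul {s : Finset R} (r : R → R) (b : R) :
    Twist.of (frobenius F p)
        (∑ y ∈ s, (algebraMap R F (r y) / algebraMap R F b) ^ p * algebraMap R F y) =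
      ∑ y ∈ s, (algebraMap R F (r y) / algebraMap R F b) •
        Twist.of (frobenius F p) (algebraMap R F y) := by
  rw [map_sum]
  rfl

variable [ExpChar R p] [IsDomain R] [IsFractionRing R F]

/-- A fraction can be given a p-th power denominator, n/b = n b^(p-1)/b^p, so generators of R over
its p-th powers also generate F over F^p. -/
theorem IsFFinite.finite_twist (h : IsFFinite R p) :
    Module.Finite F (Twist (frobenius F p) F) := by
  classical
  obtain ⟨s, hs⟩ := h.exists_finset
  refine ⟨⟨s.image fun y => Twist.of (frobenius F p) (algebraMap R F y), ?_⟩⟩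
  rw [eq_top_iff]
  intro x _
  obtain ⟨n, b, hb, hx⟩ := IsFractionRing.div_surjective (A := R) (show F from x)
  have hb0 : algebraMap R F b ≠ 0 := IsFractionRing.to_map_ne_zero_of_mem_nonZeroDivisors hb
  have hp : 0 < p := expChar_pos R p
  obtain ⟨r, hr⟩ := hs (n * b ^ (p - 1))
  have hx' : x = ∑ y ∈ s, (algebraMap R F (r y) / algebraMap R F b) •
      Twist.of (frobenius F p) (algebraMap R F y) := by
    rw [← twist_of_sum_pow_mul]
    change (show F from x) = _
    rw [← hx]
    have h1 := congrArg (algebraMap R F) hr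
    simp only [map_sum, map_mul, map_pow] at h1
    change _ = ∑ y ∈ s, (algebraMap R F (r y) / algebraMap R F b) ^ p * algebraMap R F y
    simp only [div_pow, div_mul_eq_mul_div, ← Finset.sum_div, ← h1]
    rw [div_eq_div_iff hb0 (pow_ne_zero _ hb0), mul_assoc, ← pow_succ, Nat.sub_add_cancel hp]
  rw [hx']
  refine Submodule.sum_mem _ fun y hy => Submodule.smul_mem _ _ (Submodule.subset_span ?_)
  exact Finset.mem_coe.2 (Finset.mem_image_of_mem _ hy)

/-- Clearing denominators on finitely many generators of R over its p-th powers is enough, because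
the functionals take p-th powers out as scalars. -/
theorem IsFFinite.exists_denominator (h : IsFFinite R p) {ι : Type*} [Finite ι]
    (φ : ι → Twist (frobenius F p) F →ₗ[F] F) :
    ∃ c : R, c ≠ 0 ∧ ∀ i, ∀ x : R, ∃ y : R,
      algebraMap R F y = algebraMap R F c * φ i (Twist.of _ (algebraMap R F x)) := by
  obtain ⟨s, hs⟩ := h.exists_finset
  obtain ⟨c, hc⟩ := IsLocalization.exist_integer_multiples_of_finite (nonZeroDivisors R)
    fun z : ι × s => φ z.1 (Twist.of _ (algebraMap R F z.2))
  refine ⟨c, nonZeroDivisors.ne_zero c.2, fun i x => ?_⟩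
  choose l hl using hc
  obtain ⟨r, hr⟩ := hs x
  refine ⟨∑ y ∈ s.attach, r y * l (i, y), ?_⟩
  have h1 : Twist.of (frobenius F p) (algebraMap R F x) =
      ∑ y ∈ s, algebraMap R F (r y) • Twist.of (frobenius F p) (algebraMap R F y) := by
    have := twist_of_sum_pow_mul (F := F) (p := p) (s := s) r 1
    simp only [map_one, div_one] at this
    rw [← this, hr]
    simp only [map_sum, map_mul, map_pow]
  rw [h1, ← Finset.sum_attach s, map_sum (φ i), map_sum, Finset.mul_sum]
  refine Finset.sum_congr rfl fun y _ => ?_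
  rw [map_mul, hl, map_smul, Algebra.smul_def, smul_eq_mul]
  ring

/-- Coordinates with respect to a basis of `F` over its subfield of `p`-th powers, after clearing
denominators. -/
theorem IsFFinite.exists_coordinates (h : IsFFinite R p) {ι : Type*} [Finite ι] [DecidableEq ι]
    (b : Module.Basis ι F (Twist (frobenius F p) F)) :
    ∃ (ψ : Twist (frobenius R p) R →ₗ[R] ι → R) (c : R), c ≠ 0 ∧
      ∀ i, ∃ x, ∀ j, ψ x j = if j = i then c else 0 := by
  have hinj := IsFractionRing.injective R F
  obtain ⟨c, hc0, hc⟩ := h.exists_denominator fun i => b.coord i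
  choose y hy using hc
  obtain ⟨t, ht⟩ := IsLocalization.exist_integer_multiples_of_finite (nonZeroDivisors R)
    fun i => (show F from b i)
  choose l hl using ht
  have hp : 0 < p := expChar_pos R p
  refine ⟨{ toFun := fun x i => y i x
            map_add' := fun x x' => funext fun i => hinj ?_
            map_smul' := fun r x => funext fun i => hinj ?_ }, c * t,
          mul_ne_zero hc0 (nonZeroDivisors.ne_zero t.2), fun i => ?_⟩
  · change algebraMap R F (y i (show R from x + x')) =
      algebraMap R F (y i (show R from x) + y i (show R from x'))
    rw [map_add, hy, hy, hy, ← mul_add, ← map_add, ← map_add, ← map_add]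
    rfl
  · change algebraMap R F (y i (r ^ p * (show R from x))) =
      algebraMap R F (r * y i (show R from x))
    rw [map_mul, hy, hy, map_mul, map_pow]
    have : Twist.of (frobenius F p) (algebraMap R F r ^ p * algebraMap R F (show R from x)) =
        algebraMap R F r • Twist.of (frobenius F p) (algebraMap R F (show R from x)) := rfl
    rw [this, map_smul, smul_eq_mul]
    ring
  -- Since l i = t b_i, this element is t^p b_i, which lies in R and equals t • b_i in the twisted
  -- module. Its i-th cleared coordinate is c t.
  · refine ⟨Twist.of _ ((t : R) ^ (p - 1) * l i), fun j => hinj ?_⟩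
    change algebraMap R F (y j ((t : R) ^ (p - 1) * l i)) = _
    have h1 : algebraMap R F ((t : R) ^ (p - 1) * l i) =
        (algebraMap R F t) ^ p * (show F from b i) := by
      rw [map_mul, hl, map_pow, Algebra.smul_def, ← mul_assoc, ← pow_succ, Nat.sub_add_cancel hp]
    have h2 : Twist.of (frobenius F p) ((algebraMap R F t) ^ p * (show F from b i)) =
        algebraMap R F t • b i := rfl
    rw [hy, h1, h2, map_smul, Module.Basis.coord_apply, Module.Basis.repr_self,
      Finsupp.single_apply]
    by_cases hij : i = j
    · rw [if_pos hij, if_pos hij.symm, smul_eq_mul, mul_one, map_mul]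
    · rw [if_neg hij, if_neg (Ne.symm hij), smul_zero, mul_zero, map_zero]

end FFinite

theorem exists_sub_frobenius_mem_maximalIdeal {R : Type*} [CommRing R] [IsDomain R]
    [IsLocalRing R]
    {p : ℕ} [Fact p.Prime] [CharP R p] (h : PerfectField (IsLocalRing.ResidueField R)) (t : R) :
    ∃ s : R, t - frobenius R p s ∈ IsLocalRing.maximalIdeal R := by
  have : CharP (IsLocalRing.ResidueField R) p :=
    CharP.of_ringHom_of_ne_zero (IsLocalRing.residue R) p (Fact.out : p.Prime).ne_zero
  have : PerfectRing (IsLocalRing.ResidueField R) p := PerfectField.toPerfectRing p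
  obtain ⟨x, hx⟩ := surjective_frobenius (IsLocalRing.ResidueField R) p (IsLocalRing.residue R t)
  obtain ⟨s, rfl⟩ := IsLocalRing.residue_surjective x
  refine ⟨s, ?_⟩
  rw [← IsLocalRing.residue_eq_zero_iff, map_sub, sub_eq_zero, ← hx, frobenius_def, frobenius_def,
    map_pow]

/-! ### The degree of the Frobenius endomorphism of the fraction field -/

section FrobeniusDegree

variable {d : ℕ} {a : EuclideanSpace ℝ (Fin d)} {ha : LinearIndependent ℚ (fun i => a i)}
variable {R : Type*} [CommRing R] [IsLocalRing R] {F : Type*} [Field F] [Algebra R F]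
variable {ν : AddValuation F (WithTop (OrdLattice a ha))}

open IsLocalRing (maximalIdeal)

theorem one_mem_topDimCompl {A : Type*} [CommRing A] : (1 : A) ∈ topDimCompl A :=
  fun _ hP _ h => hP.ne_top ((Ideal.eq_top_iff_one _).2 h)

theorem isBBL_sup_pow (J : Ideal R) : IsBBL (fun n => n) fun n => J ⊔ maximalIdeal R ^ n :=
  ⟨1, fun k => by rw [one_mul]; exact le_sup_right⟩

theorem isWeaklyGraded_sup_pow (J : Ideal R) :
    IsWeaklyGraded fun n => J ⊔ maximalIdeal R ^ n := by
  refine ⟨1, one_mem_topDimCompl, fun m n => ?_⟩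
  change Ideal.span {1} * ((J ⊔ maximalIdeal R ^ m) * (J ⊔ maximalIdeal R ^ n)) ≤
    J ⊔ maximalIdeal R ^ (m + n)
  rw [Ideal.span_singleton_one, Ideal.top_mul, Ideal.sup_mul, Ideal.mul_sup (maximalIdeal R ^ m),
    ← pow_add]
  have h1 : J * (J ⊔ maximalIdeal R ^ n) ≤ J := Ideal.mul_le_left
  have h2 : maximalIdeal R ^ m * J ≤ J := Ideal.mul_le_right
  exact sup_le (le_sup_of_le_left h1) (sup_le (le_sup_of_le_left h2) le_sup_right)

theorem pow_le_valueIdeal (h : IsDominatedBy R ν) {I : Ideal R} {u : OrdLattice a ha}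
    (hI : I ≤ valueIdeal h u) (n : ℕ) : I ^ n ≤ valueIdeal h (n • u) := by
  induction n with
  | zero =>
    intro r _
    rw [mem_valueIdeal, zero_nsmul]
    exact h.nonneg r
  | succ n ih =>
    rw [pow_succ, Ideal.mul_le]
    intro x hx y hy
    have h1 := (mem_valueIdeal h).1 (ih hx)
    have h2 := (mem_valueIdeal h).1 (hI hy)
    rw [mem_valueIdeal, map_mul, AddValuation.map_mul, succ_nsmul, WithTop.coe_add]
    exact add_le_add h1 h2

theorem IsOKValuation.residueDegree_ne_zero (hν : IsOKValuation R ν) :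
    residueDegree hν.dominated ≠ 0 := by
  let _ : Algebra (IsLocalRing.ResidueField R) (residueFieldOf ν) :=
    (residueExtension hν.dominated).toAlgebra
  have : Module.Finite (IsLocalRing.ResidueField R) (residueFieldOf ν) :=
    hν.finite_residueExtension
  exact (Module.finrank_pos (R := IsLocalRing.ResidueField R) (M := residueFieldOf ν)).ne'

variable [IsFractionRing R F]

/-- The fixed value of c rescales to 0, so 0 is in the upper limit and the limit region contains the
whole open cone. -/
theorem volume_limitComplement_span_sup_pow {c : R} (hc : c ≠ 0) :
    volume (limitComplement R ν (fun n => n) fun n => Ideal.span {c} ⊔ maximalIdeal R ^ n) = 0 := by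
  obtain ⟨w, hw⟩ := exists_hasValue_algebraMap ν hc
  have h0 : (0 : EuclideanSpace ℝ (Fin d)) ∈ upperLimit (fun n => n)
      fun n => latticeValueSet ν (Ideal.span {c} ⊔ maximalIdeal R ^ n) := by
    intro ε hε
    refine Eventually.frequently ?_
    filter_upwards [tendsto_natCast_atTop_atTop.eventually_ge_atTop (‖latticePoint w‖ / ε)]
      with n hn
    refine ⟨w, ⟨c, Ideal.mem_sup_left (Ideal.mem_span_singleton_self c), hw⟩, ?_⟩
    rw [smul_zero, sub_zero]
    exact (div_le_iff₀' hε).1 hn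
  have : limitComplement R ν (fun n => n) (fun n => Ideal.span {c} ⊔ maximalIdeal R ^ n) = ∅ :=
    Set.eq_empty_of_forall_notMem fun x hx =>
      hx.2 (subset_closure ⟨0, h0, x, hx.1, zero_add x⟩)
  rw [this, measure_empty]

variable [IsDomain R]

/-- The least value on 𝔪 exists because S is finite below any bound, and it is positive by
domination. -/
theorem IsOKValuation.exists_maximalIdeal_le_valueIdeal (hν : IsOKValuation R ν) :
    ∃ u : OrdLattice a ha, 0 < u ∧ maximalIdeal R ≤ valueIdeal hν.dominated u := by
  obtain ⟨v, hv⟩ := latticeValueSet_nonempty (ν := ν) hν.maximalIdeal_ne_bot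
  have hfin : {u ∈ valueSet ν (maximalIdeal R) | u ≤ v}.Finite := by
    refine ((hν.finite_lt v).insert v).subset fun u hu => ?_
    rcases hu.2.eq_or_lt with h | h
    · exact Or.inl h
    · exact Or.inr ⟨latticeValueSet_subset (maximalIdeal R) hu.1, h⟩
  obtain ⟨u, ⟨⟨x, hx, hxu⟩, huv⟩, hmin⟩ :=
    Set.exists_min_image _ (fun u => u) hfin ⟨v, hv, le_refl (α := OrdLattice a ha) v⟩
  refine ⟨u, ?_, fun r hr => ?_⟩
  · have := hν.dominated.pos x hx
    rw [hxu] at this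
    exact_mod_cast this
  · rw [mem_valueIdeal]
    by_cases hr0 : algebraMap R F r = 0
    · simp [hr0]
    · obtain ⟨t, ht⟩ := exists_map_eq_coe (ν := ν) hr0
      rw [ht, WithTop.coe_le_coe]
      rcases le_total t v with h | h
      · exact hmin t ⟨⟨r, hr, ht⟩, h⟩
      · exact huv.trans h

/-- Values on 𝔪^n are at least n u with u > 0, so the limit region lies in the half-space ⟪x, a⟫ ≥
⟪u, a⟫ and misses a nonempty open part of the cone. -/
theorem IsOKValuation.volume_limitComplement_pow_ne_zero (hν : IsOKValuation R ν) :
    volume (limitComplement R ν (fun n => n) fun n => ⊥ ⊔ maximalIdeal R ^ n) ≠ 0 := by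
  obtain ⟨u, hu, hmu⟩ := hν.exists_maximalIdeal_le_valueIdeal
  have hu0 : 0 < u.toReal := by
    have h0 : (0 : OrdLattice a ha).toReal = 0 := by
      simpa using toReal_nsmul 0 (0 : OrdLattice a ha)
    rw [← h0]
    exact lt_of_not_ge fun h => absurd hu (not_lt.2 ((OrdLattice.le_iff u 0).2 h))
  have hK : ∀ n : ℕ, ∀ v ∈ latticeValueSet ν (⊥ ⊔ maximalIdeal R ^ n),
      n * u.toReal ≤ inner ℝ (latticePoint v) a := by
    intro n v hv
    obtain ⟨x, hx, hxv⟩ := mem_latticeValueSet.1 hv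
    rw [bot_sup_eq] at hx
    have h1 := (mem_valueIdeal hν.dominated).1 (pow_le_valueIdeal hν.dominated hmu n hx)
    have h2 : n • u ≤ (show OrdLattice a ha from v) := WithTop.coe_le_coe.1 (h1.trans_eq hxv)
    rw [OrdLattice.le_iff, toReal_nsmul] at h2
    exact h2
  have hC : ∀ x ∈ openCone (valueSubmonoid R ν), 0 ≤ inner ℝ x a := by
    obtain ⟨c, hc, -, h⟩ := hν.pointed
    exact fun x hx => (mul_nonneg hc.le (norm_nonneg x)).trans (h x (interior_subset hx))
  have hupper : upperLimit (fun n => n)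
      (fun n => latticeValueSet ν (⊥ ⊔ maximalIdeal R ^ n)) ⊆ {x | u.toReal ≤ inner ℝ x a} := by
    intro x hx
    change u.toReal ≤ inner ℝ x a
    refine le_of_forall_pos_le_add fun ε hε => ?_
    have hδ : 0 < ε / (‖a‖ + 1) := by positivity
    obtain ⟨n, ⟨v, hv, hvx⟩, hn⟩ := ((hx _ hδ).and_eventually (eventually_gt_atTop 0)).exists
    have hn' : (0 : ℝ) < n := by exact_mod_cast hn
    have h1 := hK n v hv
    have h2 : inner ℝ (latticePoint v - (n : ℝ) • x) a ≤ ε * n := by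
      refine (real_inner_le_norm _ _).trans ?_
      calc ‖latticePoint v - (n : ℝ) • x‖ * ‖a‖ ≤ ε / (‖a‖ + 1) * n * (‖a‖ + 1) := by
            gcongr
            linarith
        _ = ε * n := by field_simp
    rw [inner_sub_left, real_inner_smul_left] at h2
    have h3 : (n : ℝ) * u.toReal ≤ n * (inner ℝ x a + ε) := by linarith
    exact le_of_mul_le_mul_left h3 hn'
  have hclosed : IsClosed {x : EuclideanSpace ℝ (Fin d) | u.toReal ≤ inner ℝ x a} :=
    isClosed_le continuous_const (by fun_prop)
  have hclosure : closure (limitRegion (valueSubmonoid R ν) (fun n => n)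
      fun n => latticeValueSet ν (⊥ ⊔ maximalIdeal R ^ n)) ⊆ {x | u.toReal ≤ inner ℝ x a} := by
    refine closure_minimal ?_ hclosed
    rintro _ ⟨x, hx, c, hc, rfl⟩
    have h1 : u.toReal ≤ inner ℝ x a := hupper hx
    change u.toReal ≤ inner ℝ (x + c) a
    rw [inner_add_left]
    linarith [hC c hc]
  obtain ⟨b, hb⟩ := interior_closedCone_nonempty hν.closure_valueSubmonoid
  have hopen : IsOpen (openCone (valueSubmonoid R ν) ∩
      {x : EuclideanSpace ℝ (Fin d) | u.toReal ≤ inner ℝ x a}ᶜ) :=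
    isOpen_interior.inter hclosed.isOpen_compl
  have hb0 : 0 ≤ inner ℝ b a := hC b hb
  have hpos : 0 < volume (openCone (valueSubmonoid R ν) ∩
      {x : EuclideanSpace ℝ (Fin d) | u.toReal ≤ inner ℝ x a}ᶜ) := by
    -- The multiple of b is scaled so that its inner product with a stays below that of u; the
    -- summand 1 avoids a zero denominator.
    refine hopen.measure_pos volume ⟨(u.toReal / (2 * (inner ℝ b a + 1))) • b,
      interior_closedCone_smul_mem hb (by positivity), ?_⟩
    change ¬ (u.toReal ≤ inner ℝ ((u.toReal / (2 * (inner ℝ b a + 1))) • b) a)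
    rw [real_inner_smul_left, not_le, div_mul_eq_mul_div, div_lt_iff₀ (by positivity)]
    nlinarith
  refine (hpos.trans_le (measure_mono ?_)).ne'
  exact fun x hx => ⟨hx.1, fun h => hx.2 (hclosure h)⟩

theorem IsOKValuation.tendsto_normalizedColength_sup_pow (hν : IsOKValuation R ν) (J : Ideal R) :
    Tendsto (fun n : ℕ => normalizedColength d (J ⊔ maximalIdeal R ^ n) n) atTop
      (𝓝 (residueDegree hν.dominated *
        volume (limitComplement R ν (fun n => n) fun n => J ⊔ maximalIdeal R ^ n))) :=
  hν.tendsto_normalizedColength tendsto_id (isBBL_sup_pow J)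
    (hν.hasValueLimit_of_isWeaklyGraded (isBBL_sup_pow J) (isWeaklyGraded_sup_pow J))

theorem tendsto_mul_add_pow_div_pow (p μ d : ℕ) :
    Tendsto (fun n : ℕ => ((p * (n + μ) : ℕ) : ℝ≥0∞) ^ d / (n : ℝ≥0∞) ^ d) atTop
      (𝓝 ((p : ℝ≥0∞) ^ d)) := by
  have h1 : Tendsto (fun n : ℕ => (p : ℝ) / ((n : ℝ) / (n + μ))) atTop (𝓝 ((p : ℝ) / 1)) :=
    tendsto_const_nhds.div (tendsto_natCast_div_add_atTop (μ : ℝ)) one_ne_zero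
  have h2 := ENNReal.tendsto_ofReal (h1.pow d)
  rw [div_one, ENNReal.ofReal_pow (by positivity), ENNReal.ofReal_natCast] at h2
  refine h2.congr' ?_
  filter_upwards [eventually_gt_atTop 0] with n hn
  have hn' : (0 : ℝ) < n := by exact_mod_cast hn
  have h3 : ((p : ℝ) / ((n : ℝ) / (n + μ))) ^ d = ((p * (n + μ) : ℕ) : ℝ) ^ d / (n : ℝ) ^ d := by
    rw [← div_pow]
    congr 1
    push_cast
    field_simp
  rw [h3, ENNReal.ofReal_div_of_pos (by positivity), ENNReal.ofReal_pow (by positivity),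
    ENNReal.ofReal_pow (by positivity), ENNReal.ofReal_natCast, ENNReal.ofReal_natCast]

/-- The fraction field of an `F`-finite domain of dimension `d` with perfect residue field has
degree at most `p ^ d` over its subfield of `p`-th powers. -/
theorem IsOKValuation.finrank_twist_le [IsNoetherianRing R] (hν : IsOKValuation R ν) {p : ℕ}
    [Fact p.Prime] [CharP R p] [ExpChar F p] (hfin : IsFFinite R p)
    (hperf : PerfectField (IsLocalRing.ResidueField R)) :
    Module.finrank F (Twist (frobenius F p) F) ≤ p ^ d := by
  have := hfin.finite_twist (F := F)
  set δ := Module.finrank F (Twist (frobenius F p) F)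
  obtain ⟨ψ, c, hc0, hc⟩ := hfin.exists_coordinates
    (Module.finBasis F (Twist (frobenius F p) F))
  obtain ⟨s, hs⟩ := (isNoetherianRing_iff_ideal_fg R).1 inferInstance (maximalIdeal R)
  have hp0 : 0 < p := (Fact.out : p.Prime).pos
  set L : ℝ≥0∞ := residueDegree hν.dominated *
    volume (limitComplement R ν (fun n => n) fun n => ⊥ ⊔ maximalIdeal R ^ n) with hL
  have hL0 : L ≠ 0 := mul_ne_zero (Nat.cast_ne_zero.2 hν.residueDegree_ne_zero)
    hν.volume_limitComplement_pow_ne_zero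
  have hLtop : L ≠ ⊤ := ENNReal.mul_ne_top (ENNReal.natCast_ne_top _)
    (hν.volume_limitComplement_lt_top tendsto_id (isBBL_sup_pow ⊥)
      (hν.hasValueLimit_of_isWeaklyGraded (isBBL_sup_pow ⊥) (isWeaklyGraded_sup_pow ⊥))).ne
  have h1 : Tendsto (fun n : ℕ => normalizedColength d (maximalIdeal R ^ n) n) atTop (𝓝 L) := by
    have h := hν.tendsto_normalizedColength_sup_pow ⊥
    rw [← hL] at h
    simpa only [bot_sup_eq] using h
  have h2 : Tendsto (fun n : ℕ => normalizedColength d (Ideal.span {c} ⊔ maximalIdeal R ^ n) n)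
      atTop (𝓝 0) := by
    simpa only [volume_limitComplement_span_sup_pow hc0, mul_zero] using
      hν.tendsto_normalizedColength_sup_pow (Ideal.span {c})
  have h3 : Tendsto (fun n : ℕ => p * (n + s.card)) atTop atTop :=
    tendsto_atTop_mono (fun n => (Nat.le_add_right n s.card).trans (Nat.le_mul_of_pos_left _ hp0))
      tendsto_id
  -- The perfect residue field bounds the twisted length by the ordinary one, and pigeonhole puts
  -- 𝔪^(p(n+μ)) inside the Frobenius power of 𝔪^n, with μ = `s.card`.
  have hineq : ∀ n : ℕ, δ * Module.length R (R ⧸ maximalIdeal R ^ n) ≤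
      Module.length R (R ⧸ maximalIdeal R ^ (p * (n + s.card))) +
        δ * Module.length R (R ⧸ (Ideal.span {c} ⊔ maximalIdeal R ^ n)) := by
    intro n
    have h4 := mul_length_quotient_le ψ hc (maximalIdeal R ^ n)
    rw [Fintype.card_fin] at h4
    refine h4.trans (add_le_add_left ((length_twist_le
      (exists_sub_frobenius_mem_maximalIdeal hperf)).trans (length_quotient_mono ?_)) _)
    rw [Ideal.map_pow, ← hs]
    exact pow_le_pow_of_forall_pow_mem hp0 s
      (fun y hy => Ideal.mem_map_of_mem (frobenius R p) (Ideal.subset_span hy)) n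
  -- After division by n^d the first term tends to L p^d and the error term to 0.
  have hlim := (ENNReal.Tendsto.mul (h1.comp h3) (Or.inl hL0)
    (tendsto_mul_add_pow_div_pow p s.card d)
    (Or.inr hLtop)).add (ENNReal.Tendsto.const_mul (a := (δ : ℝ≥0∞)) h2
      (Or.inr (ENNReal.natCast_ne_top _)))
  have hle := le_of_tendsto_of_tendsto (ENNReal.Tendsto.const_mul (a := (δ : ℝ≥0∞)) h1
    (Or.inr (ENNReal.natCast_ne_top _))) hlim (by
      filter_upwards [eventually_gt_atTop 0] with n hn
      have h5 := ENat.toENNReal_le.2 (hineq n)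
      rw [ENat.toENNReal_add, ENat.toENNReal_mul, ENat.toENNReal_mul, ENat.toENNReal_coe] at h5
      have hN0 : ((p * (n + s.card) : ℕ) : ℝ≥0∞) ^ d ≠ 0 :=
        pow_ne_zero _ (Nat.cast_ne_zero.2 (by positivity))
      have hNtop : ((p * (n + s.card) : ℕ) : ℝ≥0∞) ^ d ≠ ⊤ :=
        ENNReal.pow_ne_top (ENNReal.natCast_ne_top _)
      simp only [normalizedColength, Function.comp_apply]
      rw [← mul_div_assoc, ← mul_div_assoc, ← mul_div_assoc, ENNReal.div_mul_cancel hN0 hNtop,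
        ← ENNReal.add_div]
      exact ENNReal.div_le_div_right h5 _)
  -- The inequality is now δ L ≤ p^d L, and L cancels because 0 < L < ∞.
  rw [mul_zero, add_zero, mul_comm L, ENNReal.mul_le_mul_iff_left hL0 hLtop] at hle
  exact_mod_cast hle

end FrobeniusDegree

/-! ### Weakly inverse `p`-families -/

section InverseFamilies

variable {d : ℕ} {a : EuclideanSpace ℝ (Fin d)} {ha : LinearIndependent ℚ (fun i => a i)}
variable {R : Type*} [CommRing R] {F : Type*} [Field F] [Algebra R F]
variable {ν : AddValuation F (WithTop (OrdLattice a ha))}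

/-- When the nonzero terms have distinct values, the term of least value is unique and cannot be
cancelled. -/
theorem exists_map_sum_eq {ι : Type*} [Fintype ι] {f : ι → F}
    (hf : ∀ i j, f i ≠ 0 → f j ≠ 0 → ν (f i) = ν (f j) → i = j) (hne : ∃ i, f i ≠ 0) :
    ∃ i, f i ≠ 0 ∧ ν (∑ j, f j) = ν (f i) := by
  classical
  obtain ⟨i₀, hi₀⟩ := hne
  obtain ⟨i, -, hi⟩ := Finset.exists_min_image Finset.univ (fun j => ν (f j)) ⟨i₀, Finset.mem_univ _⟩
  have htop : ν (f i) ≠ ⊤ := fun h =>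
    hi₀ ((AddValuation.top_iff ν).1 (top_le_iff.1 (h ▸ hi i₀ (Finset.mem_univ _))))
  have hi0 : f i ≠ 0 := fun h => htop (by rw [h, AddValuation.map_zero])
  refine ⟨i, hi0, ?_⟩
  rw [← Finset.add_sum_erase _ _ (Finset.mem_univ i)]
  refine AddValuation.map_add_eq_of_lt_left ν (AddValuation.map_lt_sum ν htop fun j hj => ?_)
  refine lt_of_le_of_ne (hi j (Finset.mem_univ _)) fun h => ?_
  have hj0 : f j ≠ 0 := fun h0 => htop (by rw [h, h0, AddValuation.map_zero])
  exact Finset.ne_of_mem_erase hj (hf j i hj0 hi0 h.symm)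

/-- The value of r_i^p g_i is congruent to i modulo p in every coordinate, so nonzero terms with
different indices never share a value. -/
theorem exists_map_sum_pow_mul_eq {p : ℕ} {g : (Fin d → Fin p) → F}
    (hg : ∀ i, HasValue ν (g i) fun j => ((i j : ℕ) : ℤ)) {r : (Fin d → Fin p) → F}
    (hr : ∃ i, r i ≠ 0) :
    ∃ i, r i ≠ 0 ∧ ν (∑ j, r j ^ p * g j) = ν (r i ^ p * g i) := by
  -- The case p = 0, where 0^0 = 1, is settled by the index type, which is then empty or a single
  -- point.
  have h0 : ∀ i, r i ^ p * g i ≠ 0 → r i ≠ 0 := by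
    intro i hi h
    rcases Nat.eq_zero_or_pos p with rfl | hp
    · rcases Nat.eq_zero_or_pos d with rfl | hd
      · obtain ⟨i₀, hi₀⟩ := hr
        exact hi₀ (Subsingleton.elim i i₀ ▸ h)
      · exact (i ⟨0, hd⟩).elim0
    · exact hi (by rw [h, zero_pow hp.ne', zero_mul])
  obtain ⟨i, hi, h⟩ := exists_map_sum_eq (ν := ν) (f := fun i => r i ^ p * g i) (by
    intro i j hi hj hij
    obtain ⟨u, hu⟩ := exists_hasValue ν (h0 i hi)
    obtain ⟨v, hv⟩ := exists_hasValue ν (h0 j hj)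
    have hu' := (hu.pow p).mul (hg i)
    have hv' := (hv.pow p).mul (hg j)
    have huv := HasValue.unique hu' (show HasValue ν _ _ from hij.trans hv')
    funext k
    have hk : (p : ℤ) * u k + ((i k : ℕ) : ℤ) = p * v k + ((j k : ℕ) : ℤ) := by
      simpa using congrFun huv k
    have h1 := congrArg (fun z : ℤ => z % p) hk
    simp only [Int.mul_add_emod_self_left] at h1
    rw [Int.emod_eq_of_lt (by positivity) (by exact_mod_cast (i k).2),
      Int.emod_eq_of_lt (by positivity) (by exact_mod_cast (j k).2)] at h1
    exact Fin.ext (by exact_mod_cast h1)) (by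
    obtain ⟨i, hi⟩ := hr
    exact ⟨i, mul_ne_zero (pow_ne_zero _ hi) (hg i).ne_zero⟩)
  exact ⟨i, h0 i hi, h⟩

/-- A vanishing nontrivial combination would have the finite value of one of its terms. -/
theorem linearIndependent_twist_of_hasValue {p : ℕ} [ExpChar F p] {g : (Fin d → Fin p) → F}
    (hg : ∀ i, HasValue ν (g i) fun j => ((i j : ℕ) : ℤ)) :
    LinearIndependent F fun i => Twist.of (frobenius F p) (g i) := by
  rw [Fintype.linearIndependent_iff]
  intro r hr
  by_contra! h
  obtain ⟨i, hi, hν⟩ := exists_map_sum_pow_mul_eq hg h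
  have hr' : ∑ j, r j ^ p * g j = 0 := hr
  rw [hr', AddValuation.map_zero, eq_comm, AddValuation.top_iff] at hν
  exact mul_ne_zero (pow_ne_zero _ hi) (hg i).ne_zero hν

/-- A functional that is linear over p-th powers sends r z^p to z φ(r), so after clearing
denominators it maps I^[p] into I. It serves as a p-th root on ideals. -/
theorem exists_mem_of_mem_frobeniusPower {p : ℕ} [ExpChar F p]
    {φ : Twist (frobenius F p) F →ₗ[F] F} {c : R}
    (h : ∀ x : R, ∃ y : R, algebraMap R F y = algebraMap R F c * φ (Twist.of _ (algebraMap R F x)))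
    {I : Ideal R} {x : R} (hx : x ∈ frobeniusPower p I) :
    ∃ y ∈ I, algebraMap R F y = algebraMap R F c * φ (Twist.of _ (algebraMap R F x)) := by
  have key : ∀ r : R, ∃ y ∈ I,
      algebraMap R F y = algebraMap R F c * φ (Twist.of _ (algebraMap R F (r * x))) := by
    induction hx using Submodule.span_induction with
    | mem x hx =>
      obtain ⟨z, hz, rfl⟩ := hx
      intro r
      obtain ⟨y, hy⟩ := h r
      refine ⟨z * y, I.mul_mem_right _ hz, ?_⟩
      have e : Twist.of (frobenius F p) (algebraMap R F (r * z ^ p)) =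
          algebraMap R F z • Twist.of (frobenius F p) (algebraMap R F r) := by
        rw [Twist.smul_of, frobenius_def, smul_eq_mul, map_mul, map_pow, mul_comm]
      change _ = algebraMap R F c * φ (Twist.of (frobenius F p) (algebraMap R F (r * z ^ p)))
      rw [e, map_smul, map_mul, hy, smul_eq_mul]
      ring
    | zero => exact fun r => ⟨0, I.zero_mem, by simp⟩
    | add x x' _ _ hx hx' =>
      intro r
      obtain ⟨y, hyI, hy⟩ := hx r
      obtain ⟨y', hyI', hy'⟩ := hx' r
      refine ⟨y + y', I.add_mem hyI hyI', ?_⟩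
      rw [mul_add, map_add, map_add, map_add, map_add, hy, hy', mul_add]
    | smul s x _ ih =>
      intro r
      rw [smul_eq_mul, ← mul_assoc]
      exact ih (r * s)
  simpa only [one_mul] using key 1

theorem IsOKValuation.hasValueLimit_of_isWeaklyInverseP [IsDomain R] [IsNoetherianRing R]
    [IsLocalRing R] [IsFractionRing R F] (hν : IsOKValuation R ν) {p : ℕ} [Fact p.Prime]
    [CharP R p] (hfin : IsFFinite R p) (hperf : PerfectField (IsLocalRing.ResidueField R))
    {I : ℕ → Ideal R} (h : IsWeaklyInverseP p I) : HasValueLimit ν (fun e => p ^ e) I := by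
  classical
  have hp : p.Prime := Fact.out
  have : CharP F p := charP_of_injective_algebraMap (IsFractionRing.injective R F) p
  have : NeZero p := ⟨hp.ne_zero⟩
  have := hfin.finite_twist (F := F)
  obtain ⟨c, hc, hcI⟩ := h
  obtain ⟨w, hw⟩ := exists_hasValue_algebraMap ν (ne_zero_of_mem_topDimCompl hc)
  choose g hg using fun i : Fin d → Fin p =>
    hν.surjective (show OrdLattice a ha from fun j => ((i j : ℕ) : ℤ))
  replace hg : ∀ i, HasValue ν (g i) fun j => ((i j : ℕ) : ℤ) := hg
  have hli := linearIndependent_twist_of_hasValue hg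
  -- Independence gives p^d ≤ [F : F^p] and the asymptotic length comparison gives the converse, so
  -- the g i form a basis.
  have hcard : Fintype.card (Fin d → Fin p) = Module.finrank F (Twist (frobenius F p) F) := by
    refine le_antisymm hli.fintype_card_le_finrank ?_
    rw [Fintype.card_fun, Fintype.card_fin, Fintype.card_fin]
    exact hν.finrank_twist_le hfin hperf
  let b := basisOfLinearIndependentOfCardEqFinrank hli hcard
  obtain ⟨s, hs0, hs⟩ := hfin.exists_denominator fun i => b.coord i
  obtain ⟨w', hw'⟩ := exists_hasValue_algebraMap ν hs0
  refine hasValueLimit_of_exists_nsmul_near hp.one_lt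
    (M := ‖latticePoint (p • w' + w)‖ +
      ∑ i : Fin d → Fin p, ‖latticePoint fun j => ((i j : ℕ) : ℤ)‖) fun e u hu => ?_
  obtain ⟨y, hy, hyu⟩ := mem_latticeValueSet.1 hu
  have hcy : c * y ∈ frobeniusPower p (I e) :=
    hcI e (Ideal.mul_mem_mul (Ideal.mem_span_singleton_self c) hy)
  have hval : HasValue ν (algebraMap R F (c * y)) (w + u) := by
    rw [RingHom.map_mul]
    exact hw.mul hyu
  set r : (Fin d → Fin p) → F := fun i =>
    b.coord i (Twist.of (frobenius F p) (algebraMap R F (c * y))) with hr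
  have hsum : ∑ i, r i ^ p * g i = algebraMap R F (c * y) := by
    have h1 := b.sum_repr (Twist.of (frobenius F p) (algebraMap R F (c * y)))
    simp only [b, coe_basisOfLinearIndependentOfCardEqFinrank] at h1
    exact h1
  have hrne : ∃ i, r i ≠ 0 := by
    by_contra! h0
    refine hval.ne_zero ?_
    rw [← hsum]
    exact Finset.sum_eq_zero fun i _ => by rw [h0 i, zero_pow hp.ne_zero, zero_mul]
  -- A single coordinate r i decides the value of c y. This gives w + u = p v + i with v = ν(r i),
  -- so v is u/p up to a bounded error.
  obtain ⟨i, hi, hνi⟩ := exists_map_sum_pow_mul_eq hg hrne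
  obtain ⟨v, hv⟩ := exists_hasValue ν hi
  rw [hsum] at hνi
  have huv : w + u = p • v + fun j => ((i j : ℕ) : ℤ) :=
    hval.unique (show HasValue ν _ _ from hνi.trans ((hv.pow p).mul (hg i)))
  obtain ⟨z, hzI, hz⟩ := exists_mem_of_mem_frobeniusPower (hs i) hcy
  -- The cleared coordinate s · r i lies in I e, since c y ∈ (I e)^[p]; its value is w' + v with w'
  -- = ν(s).
  refine ⟨w' + v, ⟨z, hzI, ?_⟩, ?_⟩
  · rw [hz]
    exact hw'.mul hv
  · have e1 : (p : ℝ) • latticePoint (w' + v) - latticePoint u =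
        latticePoint (p • w' + w) - latticePoint fun j => ((i j : ℕ) : ℤ) := by
      have h2 := congrArg latticePoint huv
      rw [latticePoint_add, latticePoint_add, latticePoint_nsmul] at h2
      rw [latticePoint_add, latticePoint_add, latticePoint_nsmul, smul_add,
        eq_sub_of_add_eq' h2]
      abel
    rw [e1]
    refine (norm_sub_le _ _).trans (add_le_add_right ?_ _)
    exact Finset.single_le_sum (f := fun i : Fin d → Fin p =>
      ‖latticePoint fun j => ((i j : ℕ) : ℤ)‖) (fun _ _ => norm_nonneg _) (Finset.mem_univ i)

end InverseFamilies

end OKDomain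

/-! ### The three families: agreement of the Kuratowski limits gives each formula. -/

theorem mainTheorem7
    {R : Type*} [CommRing R] [IsDomain R] [IsNoetherianRing R] [IsLocalRing R]
    {F : Type*} [Field F] [Algebra R F] [IsFractionRing R F]
    {d : ℕ} {a : EuclideanSpace ℝ (Fin d)} {ha : LinearIndependent ℚ (fun i => a i)}
    (ν : AddValuation F (WithTop (OKDomain.OrdLattice a ha)))
    (hν : OKDomain.IsOKValuation R ν) :
    (∀ I : ℕ → Ideal R,
      OKDomain.IsBBL (fun n => n) I → OKDomain.IsWeaklyGraded I →
        volume (OKDomain.nablaUp ν (fun n => n) I) < ⊤ ∧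
        volume (OKDomain.nablaLow ν (fun n => n) I)
          = volume (OKDomain.nablaUp ν (fun n => n) I) ∧
        Tendsto (fun n : ℕ => OKDomain.normalizedColength d (I n) n) atTop
          (𝓝 ((OKDomain.residueDegree hν.dominated : ℝ≥0∞)
            * volume (OKDomain.nablaUp ν (fun n => n) I)))) ∧
    (∀ (p : ℕ) [Fact p.Prime] [CharP R p] (I : ℕ → Ideal R),
      OKDomain.IsBBL (fun e => p ^ e) I → OKDomain.IsWeaklyP p I →
        volume (OKDomain.nablaUp ν (fun e => p ^ e) I) < ⊤ ∧
        Tendsto (fun e : ℕ => OKDomain.normalizedColength d (I e) (p ^ e)) atTop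
          (𝓝 ((OKDomain.residueDegree hν.dominated : ℝ≥0∞)
            * volume (OKDomain.nablaUp ν (fun e => p ^ e) I)))) ∧
    (∀ (p : ℕ) [Fact p.Prime] [CharP R p] (I : ℕ → Ideal R),
      OKDomain.IsFFinite R p → PerfectField (IsLocalRing.ResidueField R) →
      OKDomain.IsBBL (fun e => p ^ e) I → OKDomain.IsWeaklyInverseP p I →
        volume (OKDomain.nablaUp ν (fun e => p ^ e) I) < ⊤ ∧
        Tendsto (fun e : ℕ => OKDomain.normalizedColength d (I e) (p ^ e)) atTop
          (𝓝 ((OKDomain.residueDegree hν.dominated : ℝ≥0∞)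
            * volume (OKDomain.nablaUp ν (fun e => p ^ e) I)))) := by
  refine ⟨fun I hI h => ?_, fun p _ _ I hI h => ?_, fun p _ _ I hfin hperf hI h => ?_⟩
  · have hlim := hν.hasValueLimit_of_isWeaklyGraded hI h
    have hN : Tendsto (fun n : ℕ => n) atTop atTop := tendsto_id
    rw [hν.volume_nablaUp_eq hN hlim, hν.volume_nablaLow_eq hN hlim]
    exact ⟨hν.volume_limitComplement_lt_top hN hI hlim, rfl,
      hν.tendsto_normalizedColength hN hI hlim⟩
  · have hp : 1 < p := (Fact.out : p.Prime).one_lt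
    have hlim := OKDomain.hasValueLimit_of_isWeaklyP (ν := ν) hp h
    have hN := OKDomain.tendsto_pow_atTop_nat hp
    rw [hν.volume_nablaUp_eq hN hlim]
    exact ⟨hν.volume_limitComplement_lt_top hN hI hlim,
      hν.tendsto_normalizedColength hN hI hlim⟩
  · have hlim := hν.hasValueLimit_of_isWeaklyInverseP hfin hperf h
    have hN := OKDomain.tendsto_pow_atTop_nat (Fact.out : p.Prime).one_lt
    rw [hν.volume_nablaUp_eq hN hlim]
    exact ⟨hν.volume_limitComplement_lt_top hN hI hlim,
      hν.tendsto_normalizedColength hN hI hlim⟩
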